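/- **Conventions.** All manifolds and maps are smooth, and $Y^{[p]}$ is the $p$-fold fibre product of a surjective submersion $\pi\colon Y\to M$. For $h\colon Y\to\mathbb Z$ put $\delta(h)(y_1,y_2)=h(y_2)-h(y_1)$ on $Y^{[2]}$, and for $g\colon Y^{[2]}\to\mathbb Z$ put $\delta(g)(y_1,y_2,y_3)=g(y_2,y_3)-g(y_1,y_3)+g(y_1,y_2)$ on $Y^{[3]}$. A *bundle gerbe* $(P,Y)$ over $M$ is a Hermitian line bundle $P\to Y^{[2]}$ with an associative multiplication, given by a smooth unitary isomorphism $P_{(y_1,y_2)}\otimes P_{(y_2,y_3)}\cong P_{(y_1,y_3)}$ over $Y^{[3]}$. Its *dual* is $(P^*,Y)$. The *product* $(P,Y)\otimes(Q,X)$ is the bundle gerbe over $Y\times_MX$ with fibres $P_{(y_1,y_2)}\otimes Q_{(x_1,x_2)}$, and the *reduced product* of $(P,Y)$ and $(Q,Y)$ is the bundle gerbe over $Y$ with fibres $P_{(y_1,y_2)}\otimes Q_{(y_1,y_2)}$ (the empty reduced product is the trivial bundle gerbe). A *trivialisation* of $(P,Y)$ with trivialising line bundle $R\to Y$ is an isomorphism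 of Hermitian line bundles $P\cong\delta(R)$, where $\delta(R)_{(y_1,y_2)}=R_{y_2}\otimes R_{y_1}^*$, which takes the multiplication of $P$ to the contraction $R_{y_2}\otimes R_{y_1}^*\otimes R_{y_3}\otimes R_{y_2}^*\to R_{y_3}\otimes R_{y_1}^*$. Bundle gerbes $(P,Y)$ and $(Q,X)$ over $M$ are *stably isomorphic* if $(P,Y)^*\otimes(Q,X)$ has a trivialisation. For a Hermitian line bundle $K\to Z$ and a locally constant $h\colon Z\to\mathbb Z$, $K^h\to Z$ is the Hermitian line bundle with fibres $K_z^{h(z)}$ (where $K_z^0=\mathbb C$ and $K_z^{-k}=(K_z^*)^{k}$). For a Hermitian line bundle $L\to M$ and a locally constant $g\colon Y^{[2]}\to\mathbb Z$ with $\delta(g)=0$, the *cup product bundle gerbe* $(L^g,Y)$ has fibre $L_m^{g(y_1,y_2)}$ over $(y_1,y_2)$, with $m=\pi(y_1)=\pi(y_2)$, and the canonical multiplication $L_m^{g(y_1,y_2)}\otimes L_m^{g(y_2,y_3)}=L_m^{g(y_1,y_3)}$. **Statement.** Let $Y\to M$ and $X\to M$ be surjective submersions. For $i=1,\dots,n$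 let $L_i\to M$ be a Hermitian line bundle, and let $f_i\colon Y^{[2]}\to\mathbb Z$ and $g_i\colon X^{[2]}\to\mathbb Z$ be locally constant with $\delta(f_i)=0$ and $\delta(g_i)=0$, so that $(L_i^{f_i},Y)$ and $(L_i^{g_i},X)$ are cup product bundle gerbes over $M$. Suppose there are locally constant functions $h_i\colon X\times_MY\to\mathbb Z$ with $f_i-g_i=\delta(h_i)$ on $(X\times_MY)^{[2]}$ for all $i$, that is, $$f_i(y_1,y_2)-g_i(x_1,x_2)=h_i(x_2,y_2)-h_i(x_1,y_1).$$ Let $P$ be the reduced product of the $(L_i^{f_i},Y)$ and $Q$ the reduced product of the $(L_i^{g_i},X)$, for $i=1,\dots,n$. Then $P$ and $Q$ are stably isomorphic. Moreover, $Q^*\otimes P$, a bundle gerbe over $X\times_MY$, has a trivialisation with trivialising line bundle $\bigotimes_{i=1}^nL_i^{h_i}\to X\times_MY$, where $L_i$ is pulled back to $X\times_MY$. -/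

import Mathlib

open scoped Manifold ContDiff TensorProduct InnerProductSpace Topology

universe l u v w

noncomputable section

/-! ## Smooth spaces

Fibre products of surjective submersions are embedded submanifolds of products.  Manifolds and
fibre products of manifolds are treated uniformly through their topology together with their
smooth parametrisations (plots) `ℝⁿ → Z`.  On a manifold the plots are the smooth maps; on a product
they are the pairs of plots; on a subset they are the plots of the ambient space with values in
the subset (for an embedded submanifold these are exactly the smooth maps into it).  A function on
an open subset of a manifold is smooth if and only if its composites with all plots are
(see `SmoothSpace.smoothOn_ofManifold_iff`). -/

/-- A topological space with a diffeology whose plots are continuous. -/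
structure SmoothSpace where
  carrier : Type u
  [top : TopologicalSpace carrier]
  [diffeology : DiffeologicalSpace carrier]
  continuous_of_isPlot : ∀ {n : ℕ} {p : EuclideanSpace ℝ (Fin n) → carrier},
    Diffeology.IsPlot p → Continuous p

namespace SmoothSpace

instance : CoeSort SmoothSpace (Type u) := ⟨SmoothSpace.carrier⟩
instance (Z : SmoothSpace.{u}) : TopologicalSpace Z := Z.top
instance (Z : SmoothSpace.{u}) : DiffeologicalSpace Z := Z.diffeology

/-- The diffeology of a smooth manifold: the plots are the smooth maps `ℝⁿ → M`. -/
@[reducible] def manifoldDiffeology {E H : Type*} [NormedAddCommGroup E] [NormedSpace ℝ E]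
    [TopologicalSpace H] (I : ModelWithCorners ℝ E H) (M : Type u) [TopologicalSpace M]
    [ChartedSpace H M] : DiffeologicalSpace M where
  plots n := {p | ContMDiff 𝓘(ℝ, EuclideanSpace ℝ (Fin n)) I ∞ p}
  constant_plots _ := contMDiff_const
  plot_reparam hp hf := ContMDiff.comp hp hf.contMDiff
  locality := by
    intro n p hp x
    obtain ⟨U, hU, hxU, h⟩ := hp x
    obtain ⟨ε, hε, hεU⟩ := Metric.isOpen_iff.mp hU x hxU
    have h1 : ContMDiff 𝓘(ℝ, EuclideanSpace ℝ (Fin n)) I ∞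
        (p ∘ OpenPartialHomeomorph.univBall x ε) := by
      refine h (fun y => hεU ?_) OpenPartialHomeomorph.contDiff_univBall
      have := (OpenPartialHomeomorph.univBall x ε).map_source (x := y) (by simp)
      rwa [OpenPartialHomeomorph.univBall_target x hε] at this
    have h2 : ContMDiffOn 𝓘(ℝ, EuclideanSpace ℝ (Fin n)) I ∞
        ((p ∘ OpenPartialHomeomorph.univBall x ε) ∘ (OpenPartialHomeomorph.univBall x ε).symm)
        (Metric.ball x ε) :=
      h1.comp_contMDiffOn
        (OpenPartialHomeomorph.contDiffOn_univBall_symm (c := x) (r := ε)).contMDiffOn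
    have h3 : ContMDiffOn 𝓘(ℝ, EuclideanSpace ℝ (Fin n)) I ∞ p (Metric.ball x ε) := by
      refine h2.congr fun y hy => ?_
      rw [← OpenPartialHomeomorph.univBall_target x hε] at hy
      simp [(OpenPartialHomeomorph.univBall x ε).right_inv hy]
    exact (h3 x (Metric.mem_ball_self hε)).contMDiffAt (Metric.ball_mem_nhds x hε)

/-- A smooth manifold as a smooth space. -/
def ofManifold {E H : Type*} [NormedAddCommGroup E] [NormedSpace ℝ E]
    [TopologicalSpace H] (I : ModelWithCorners ℝ E H) (M : Type u) [TopologicalSpace M]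
    [ChartedSpace H M] : SmoothSpace.{u} where
  carrier := M
  diffeology := manifoldDiffeology I M
  continuous_of_isPlot hp := ContMDiff.continuous hp

/-- The product of two smooth spaces. -/
def prod (Z : SmoothSpace.{u}) (W : SmoothSpace.{v}) : SmoothSpace.{max u v} where
  carrier := Z × W
  diffeology :=
    { plots := fun _ => {p | Diffeology.IsPlot (fun x => (p x).1) ∧
        Diffeology.IsPlot (fun x => (p x).2)}
      constant_plots := fun _ => ⟨Diffeology.isPlot_const, Diffeology.isPlot_const⟩
      plot_reparam := fun hp hf =>
        ⟨Diffeology.isPlot_reparam hp.1 hf, Diffeology.isPlot_reparam hp.2 hf⟩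
      locality := fun hp =>
        ⟨DiffeologicalSpace.locality fun x => by
          obtain ⟨U, hU, hx, h⟩ := hp x
          exact ⟨U, hU, hx, fun hf hf' => (h hf hf').1⟩,
        DiffeologicalSpace.locality fun x => by
          obtain ⟨U, hU, hx, h⟩ := hp x
          exact ⟨U, hU, hx, fun hf hf' => (h hf hf').2⟩⟩ }
  continuous_of_isPlot hp :=
    (Z.continuous_of_isPlot hp.1).prodMk (W.continuous_of_isPlot hp.2)

/-- A subset of a smooth space with the subspace topology; the plots are the plots of the ambient
space that take values in the subset. -/
def sub (Z : SmoothSpace.{u}) (S : Set Z) : SmoothSpace.{u} where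
  carrier := S
  diffeology :=
    { plots := fun _ => {p | Diffeology.IsPlot (fun x => (p x : Z))}
      constant_plots := fun _ => Diffeology.isPlot_const
      plot_reparam := fun hp hf => Diffeology.isPlot_reparam hp hf
      locality := fun hp => DiffeologicalSpace.locality fun x => by
          obtain ⟨U, hU, hx, h⟩ := hp x
          exact ⟨U, hU, hx, fun hf hf' => h hf hf'⟩ }
  continuous_of_isPlot hp := (Z.continuous_of_isPlot hp).subtype_mk _

/-- A complex-valued function is smooth on `U` if its composites with all plots are smooth
(where they take values in `U`). Used for open `U`. -/
def SmoothOn {Z : SmoothSpace.{u}} (f : Z → ℂ) (U : Set Z) : Prop :=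
  ∀ (n : ℕ) (p : EuclideanSpace ℝ (Fin n) → Z), Diffeology.IsPlot p →
    ContDiffOn ℝ ∞ (f ∘ p) (p ⁻¹' U)

end SmoothSpace

/-- Smooth maps of smooth spaces: continuous maps that send plots to plots. -/
structure SmoothMap (Z : SmoothSpace.{u}) (W : SmoothSpace.{v}) where
  toFun : Z → W
  continuous : Continuous toFun
  dSmooth : Diffeology.DSmooth toFun

namespace SmoothMap

instance (Z : SmoothSpace.{u}) (W : SmoothSpace.{v}) : CoeFun (SmoothMap Z W) (fun _ => Z → W) :=
  ⟨SmoothMap.toFun⟩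

def comp {Z : SmoothSpace.{u}} {W : SmoothSpace.{v}} {V : SmoothSpace.{w}}
    (g : SmoothMap W V) (f : SmoothMap Z W) : SmoothMap Z V where
  toFun z := g (f z)
  continuous := g.continuous.comp f.continuous
  dSmooth := g.dSmooth.comp f.dSmooth

def fst (Z : SmoothSpace.{u}) (W : SmoothSpace.{v}) : SmoothMap (Z.prod W) Z where
  toFun := Prod.fst
  continuous := continuous_fst
  dSmooth _ _ hp := hp.1

def snd (Z : SmoothSpace.{u}) (W : SmoothSpace.{v}) : SmoothMap (Z.prod W) W where
  toFun := Prod.snd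
  continuous := continuous_snd
  dSmooth _ _ hp := hp.2

def prodMk {V : SmoothSpace.{w}} {Z : SmoothSpace.{u}} {W : SmoothSpace.{v}}
    (f : SmoothMap V Z) (g : SmoothMap V W) : SmoothMap V (Z.prod W) where
  toFun x := (f x, g x)
  continuous := f.continuous.prodMk g.continuous
  dSmooth n p hp := ⟨f.dSmooth n p hp, g.dSmooth n p hp⟩

def incl (Z : SmoothSpace.{u}) (S : Set Z) : SmoothMap (Z.sub S) Z where
  toFun := Subtype.val
  continuous := continuous_subtype_val
  dSmooth _ _ hp := hp

def codRestrict {Z : SmoothSpace.{u}} {W : SmoothSpace.{v}} (f : SmoothMap Z W) (S : Set W)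
    (h : ∀ z, f z ∈ S) : SmoothMap Z (W.sub S) where
  toFun z := ⟨f z, h z⟩
  continuous := f.continuous.subtype_mk h
  dSmooth n p hp := f.dSmooth n p hp

/-- A smooth map of manifolds as a map of smooth spaces. -/
def ofContMDiff {E H E' H' : Type*} [NormedAddCommGroup E] [NormedSpace ℝ E]
    [TopologicalSpace H] {I : ModelWithCorners ℝ E H} {M : Type u} [TopologicalSpace M]
    [ChartedSpace H M] [NormedAddCommGroup E'] [NormedSpace ℝ E']
    [TopologicalSpace H'] {J : ModelWithCorners ℝ E' H'} {N : Type v} [TopologicalSpace N]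
    [ChartedSpace H' N] {f : M → N} (hf : ContMDiff I J ∞ f) :
    SmoothMap (SmoothSpace.ofManifold I M) (SmoothSpace.ofManifold J N) where
  toFun := f
  continuous := hf.continuous
  dSmooth _ p hp := by
    have hp' : ContMDiff _ I ∞ (M := EuclideanSpace ℝ (Fin _)) (M' := M) p := hp
    exact hf.comp hp'

end SmoothMap

namespace SmoothSpace

section SmoothOn

variable {Z : SmoothSpace.{u}} {f g : Z → ℂ} {U V : Set Z}

theorem SmoothOn.mono (hf : SmoothOn f U) (h : V ⊆ U) : SmoothOn f V :=
  fun n p hp => (hf n p hp).mono (Set.preimage_mono h)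

theorem SmoothOn.mul (hf : SmoothOn f U) (hg : SmoothOn g U) :
    SmoothOn (fun z => f z * g z) U :=
  fun n p hp => (hf n p hp).mul (hg n p hp)

theorem SmoothOn.conj (hf : SmoothOn f U) :
    SmoothOn (fun z => (starRingEnd ℂ) (f z)) U :=
  fun n p hp => Complex.conjCLE.contDiff.comp_contDiffOn (hf n p hp)

theorem SmoothOn.const (c : ℂ) : SmoothOn (fun _ : Z => c) U :=
  fun _ _ _ => contDiffOn_const

theorem SmoothOn.congr (hf : SmoothOn f U) (h : ∀ z ∈ U, g z = f z) : SmoothOn g U :=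
  fun n p hp => (hf n p hp).congr fun x hx => h (p x) hx

theorem SmoothOn.pow (hf : SmoothOn f U) (k : ℕ) : SmoothOn (fun z => f z ^ k) U :=
  fun n p hp => (hf n p hp).pow k

theorem SmoothOn.comp {W : SmoothSpace.{v}} (hf : SmoothOn f U) (q : SmoothMap W Z) :
    SmoothOn (fun w => f (q w)) (q ⁻¹' U) :=
  fun n p hp => hf n (q ∘ p) (q.dSmooth n p hp)

/-- A family of smooth functions indexed by the integers may be evaluated at a locally constant
index. -/
theorem SmoothOn.locallyConstant {F : ℤ → Z → ℂ} (hF : ∀ k, SmoothOn (F k) U) {h : Z → ℤ}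
    (hh : IsLocallyConstant h) : SmoothOn (fun z => F (h z) z) U := by
  intro n p hp x hx
  refine ((hF (h (p x)) n p hp) x hx).congr_of_eventuallyEq ?_ rfl
  have h1 : ∀ᶠ z in 𝓝 (p x), h z = h (p x) := hh.eventually_eq (p x)
  filter_upwards [nhdsWithin_le_nhds
    ((Z.continuous_of_isPlot hp).continuousAt.eventually h1)] with y hy
  simp [hy]

end SmoothOn

/-- On a manifold, smoothness in terms of plots is the usual smoothness. -/
theorem smoothOn_ofManifold_iff {E H : Type*} [NormedAddCommGroup E] [NormedSpace ℝ E]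
    [FiniteDimensional ℝ E] [TopologicalSpace H] (I : ModelWithCorners ℝ E H) [I.Boundaryless]
    (M : Type u) [TopologicalSpace M] [ChartedSpace H M] [IsManifold I ∞ M]
    (f : M → ℂ) {U : Set M} (hU : IsOpen U) :
    SmoothOn (Z := ofManifold I M) f U ↔ ContMDiffOn I 𝓘(ℝ, ℂ) ∞ f U := by
  constructor
  · intro h x hx
    have hxt : extChartAt I x x ∈ (extChartAt I x).target := mem_extChartAt_target x
    let e : E ≃L[ℝ] EuclideanSpace ℝ (Fin (Module.finrank ℝ E)) := toEuclidean
    let T : Set E := (extChartAt I x).target ∩ (extChartAt I x).symm ⁻¹' U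
    have hT : IsOpen (e.symm ⁻¹' T) :=
      ((continuousOn_extChartAt_symm x).isOpen_inter_preimage
        (isOpen_extChartAt_target x) hU).preimage e.symm.continuous
    obtain ⟨ε, hε, hεT⟩ := Metric.isOpen_iff.mp hT (e (extChartAt I x x)) (by simpa [T] using hx)
    set b := OpenPartialHomeomorph.univBall (e (extChartAt I x x)) ε with hb
    have hbT : ∀ y, e.symm (b y) ∈ T := fun y => hεT (by
      have := b.map_source (x := y) (by simp [hb])
      rwa [OpenPartialHomeomorph.univBall_target _ hε] at this)
    have hp : ContMDiff 𝓘(ℝ, EuclideanSpace ℝ (Fin (Module.finrank ℝ E))) I ∞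
        (fun y => (extChartAt I x).symm (e.symm (b y))) := by
      refine (contMDiffOn_extChartAt_symm x).comp_contMDiff ?_ (fun y => (hbT y).1)
      exact (e.symm.contDiff.comp OpenPartialHomeomorph.contDiff_univBall).contMDiff
    have h1 := (h _ (fun y => (extChartAt I x).symm (e.symm (b y))) hp)
    have h2 : ContDiff ℝ ∞ (f ∘ fun y => (extChartAt I x).symm (e.symm (b y))) := by
      rw [← contDiffOn_univ]
      exact h1.mono fun y _ => (hbT y).2
    have h3 : ContMDiffAt I 𝓘(ℝ, EuclideanSpace ℝ (Fin (Module.finrank ℝ E))) ∞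
        (fun z => b.symm (e (extChartAt I x z))) x := by
      have h4 : ContMDiffAt 𝓘(ℝ, EuclideanSpace ℝ (Fin (Module.finrank ℝ E)))
          𝓘(ℝ, EuclideanSpace ℝ (Fin (Module.finrank ℝ E))) ∞ b.symm (e (extChartAt I x x)) :=
        ((OpenPartialHomeomorph.contDiffOn_univBall_symm.contDiffAt
          (Metric.ball_mem_nhds _ hε))).contMDiffAt
      exact h4.comp x (e.contDiff.contMDiff.contMDiffAt.comp x contMDiffAt_extChartAt)
    refine (ContMDiffAt.congr_of_eventuallyEq (h2.contMDiff.contMDiffAt.comp x h3) ?_).contMDiffWithinAt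
    have h5 : ∀ᶠ z in 𝓝 x, e (extChartAt I x z) ∈ Metric.ball (e (extChartAt I x x)) ε :=
      (e.continuous.continuousAt.comp (continuousAt_extChartAt x)).eventually
        (Metric.ball_mem_nhds _ hε)
    filter_upwards [h5, extChartAt_source_mem_nhds (I := I) x] with z hz hz'
    rw [← OpenPartialHomeomorph.univBall_target _ hε] at hz
    rw [Function.comp_apply, Function.comp_apply, hb, OpenPartialHomeomorph.right_inv _ hz,
      e.symm_apply_apply, (extChartAt I x).left_inv hz']
  · intro h n p hp
    have hp' : ContMDiff 𝓘(ℝ, EuclideanSpace ℝ (Fin n)) I ∞ (M' := M) p := hp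
    exact (h.comp hp'.contMDiffOn (fun y hy => hy)).contDiffOn

end SmoothSpace

/-! ## Hermitian lines -/

/-- A Hermitian line: a one-dimensional complex inner product space. -/
structure HermitianLine where
  carrier : Type u
  [normed : NormedAddCommGroup carrier]
  [innerProduct : InnerProductSpace ℂ carrier]
  finrank_eq_one : Module.finrank ℂ carrier = 1

namespace HermitianLine

instance : CoeSort HermitianLine (Type u) := ⟨HermitianLine.carrier⟩
instance (L : HermitianLine.{u}) : NormedAddCommGroup L := L.normed
instance (L : HermitianLine.{u}) : InnerProductSpace ℂ L := L.innerProduct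
instance (L : HermitianLine.{u}) : FiniteDimensional ℂ L :=
  Module.finite_of_finrank_eq_succ L.finrank_eq_one
instance (L : HermitianLine.{u}) : CompleteSpace L := FiniteDimensional.complete ℂ L

theorem exists_unit (L : HermitianLine.{u}) : ∃ s : L, ‖s‖ = 1 := by
  have : Nontrivial L := Module.nontrivial_of_finrank_eq_succ L.finrank_eq_one
  exact exists_norm_eq L zero_le_one

theorem eq_smul {L : HermitianLine.{u}} {s : L} (hs : ‖s‖ = 1) (x : L) : x = ⟪s, x⟫_ℂ • s := by
  have hs0 : s ≠ 0 := by rintro rfl; simp at hs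
  obtain ⟨c, rfl⟩ := (finrank_eq_one_iff_of_nonzero' s hs0).mp L.finrank_eq_one x
  rw [inner_smul_right, inner_self_eq_norm_sq_to_K, hs]
  simp

/-- A linear map between Hermitian lines taking some unit vector to a unit vector is a unitary
isomorphism. -/
def unitaryOfLinear {L : HermitianLine.{u}} {K : HermitianLine.{v}} (f : L →ₗ[ℂ] K)
    (h : ∃ s : L, ‖s‖ = 1 ∧ ‖f s‖ = 1) : L ≃ₗᵢ[ℂ] K :=
  LinearIsometry.toLinearIsometryEquiv
    { f with
      norm_map' := by
        obtain ⟨s, hs, hfs⟩ := h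
        intro x
        rw [eq_smul hs x]
        simp [norm_smul, hs, hfs] }
    (by rw [L.finrank_eq_one, K.finrank_eq_one])

@[simp] theorem unitaryOfLinear_apply {L : HermitianLine.{u}} {K : HermitianLine.{v}}
    (f : L →ₗ[ℂ] K) (h : ∃ s : L, ‖s‖ = 1 ∧ ‖f s‖ = 1) (x : L) : unitaryOfLinear f h x = f x :=
  rfl

/-- The unitary isomorphism of Hermitian lines taking the unit vector `s` to the unit vector `t`. -/
def unitaryOfUnit {L : HermitianLine.{u}} {K : HermitianLine.{v}} {s : L} {t : K}
    (hs : ‖s‖ = 1) (ht : ‖t‖ = 1) : L ≃ₗᵢ[ℂ] K :=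
  unitaryOfLinear ((innerₛₗ ℂ s).smulRight t)
    ⟨s, hs, by simp [inner_self_eq_norm_sq_to_K, hs, ht]⟩

theorem unitaryOfUnit_apply {L : HermitianLine.{u}} {K : HermitianLine.{v}} {s : L} {t : K}
    (hs : ‖s‖ = 1) (ht : ‖t‖ = 1) : unitaryOfUnit hs ht s = t := by
  simp [unitaryOfUnit, inner_self_eq_norm_sq_to_K, hs]

/-- The trivial Hermitian line `ℂ` (lifted to the universe `u`). -/
def trivial : HermitianLine.{u} :=
  letI : InnerProductSpace ℂ (ULift.{u} ℂ) :=
    { inner := fun x y => ⟪x.down, y.down⟫_ℂ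
      norm_sq_eq_re_inner := fun x => InnerProductSpace.norm_sq_eq_re_inner x.down
      conj_inner_symm := fun x y => inner_conj_symm x.down y.down
      add_left := fun x y z => inner_add_left x.down y.down z.down
      smul_left := fun x y r => inner_smul_left x.down y.down r }
  { carrier := ULift.{u} ℂ
    finrank_eq_one := by
      rw [LinearEquiv.finrank_eq (ULift.moduleEquiv (R := ℂ) (M := ℂ))]; simp }

/-- The vector `1` of the trivial line. -/
def one : trivial.{u} := ULift.up (1 : ℂ)

theorem norm_one : ‖one.{u}‖ = 1 := CStarRing.norm_one (E := ℂ)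

/-- The tensor product of Hermitian lines. -/
def tensor (L K : HermitianLine.{u}) : HermitianLine.{u} where
  carrier := L ⊗[ℂ] K
  finrank_eq_one := by
    rw [Module.finrank_tensorProduct, L.finrank_eq_one, K.finrank_eq_one]

/-- The elementary tensor `x ⊗ y`. -/
def tmul {L K : HermitianLine.{u}} (x : L) (y : K) : L.tensor K := x ⊗ₜ[ℂ] y

theorem inner_tmul {L K : HermitianLine.{u}} (x x' : L) (y y' : K) :
    ⟪tmul x y, tmul x' y'⟫_ℂ = ⟪x, x'⟫_ℂ * ⟪y, y'⟫_ℂ := rfl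

theorem norm_tmul {L K : HermitianLine.{u}} (x : L) (y : K) : ‖tmul x y‖ = ‖x‖ * ‖y‖ :=
  TensorProduct.norm_tmul x y

/-- The dual inner product on the dual of a Hilbert space, for which the Riesz map is
anti-unitary. Its norm is the operator norm. -/
@[reducible] def dualInnerProductSpace (V : Type u) [NormedAddCommGroup V] [InnerProductSpace ℂ V]
    [CompleteSpace V] : InnerProductSpace ℂ (StrongDual ℂ V) where
  inner φ ψ := ⟪(InnerProductSpace.toDual ℂ V).symm ψ, (InnerProductSpace.toDual ℂ V).symm φ⟫_ℂ
  norm_sq_eq_re_inner φ := by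
    rw [← LinearIsometryEquiv.norm_map (InnerProductSpace.toDual ℂ V).symm φ]
    exact InnerProductSpace.norm_sq_eq_re_inner _
  conj_inner_symm φ ψ := inner_conj_symm _ _
  add_left φ ψ χ := by rw [map_add, inner_add_right]
  smul_left φ ψ r := by rw [map_smulₛₗ, inner_smul_right]

/-- The dual of a Hermitian line. -/
def dual (L : HermitianLine.{u}) : HermitianLine.{u} :=
  letI := dualInnerProductSpace L
  { carrier := StrongDual ℂ L
    finrank_eq_one := by
      exact (LinearEquiv.finrank_eq
        (LinearMap.toContinuousLinearMap (𝕜 := ℂ) (E := L) (F' := ℂ))).symm.trans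
          (Subspace.dual_finrank_eq.trans L.finrank_eq_one) }

/-- The functional `⟪s, ·⟫`. For a unit vector `s` it is the dual vector of `s`. -/
def dualVec {L : HermitianLine.{u}} (s : L) : L.dual := InnerProductSpace.toDual ℂ L s

theorem inner_dualVec {L : HermitianLine.{u}} (s t : L) :
    ⟪dualVec s, dualVec t⟫_ℂ = (starRingEnd ℂ) ⟪s, t⟫_ℂ := by
  rw [inner_conj_symm]
  change ⟪(InnerProductSpace.toDual ℂ L).symm (InnerProductSpace.toDual ℂ L t),
    (InnerProductSpace.toDual ℂ L).symm (InnerProductSpace.toDual ℂ L s)⟫_ℂ = _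
  simp

theorem norm_dualVec {L : HermitianLine.{u}} (s : L) : ‖dualVec s‖ = ‖s‖ :=
  (InnerProductSpace.toDual ℂ L).norm_map s

/-- The `k`-fold tensor power of a Hermitian line. -/
def npow (L : HermitianLine.{u}) : ℕ → HermitianLine.{u}
  | 0 => trivial
  | k + 1 => (npow L k).tensor L

/-- The `k`-fold tensor power of a vector. -/
def npowVec {L : HermitianLine.{u}} (s : L) : (k : ℕ) → L.npow k
  | 0 => one
  | k + 1 => tmul (npowVec s k) s

theorem inner_npowVec {L : HermitianLine.{u}} (s t : L) (k : ℕ) :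
    ⟪npowVec s k, npowVec t k⟫_ℂ = ⟪s, t⟫_ℂ ^ k := by
  induction k with
  | zero =>
    change ⟪(1 : ℂ), (1 : ℂ)⟫_ℂ = _
    simp
  | succ k ih => rw [pow_succ, ← ih]; exact inner_tmul _ _ _ _

theorem norm_npowVec {L : HermitianLine.{u}} (s : L) (k : ℕ) : ‖npowVec s k‖ = ‖s‖ ^ k := by
  induction k with
  | zero => rw [pow_zero]; exact norm_one.{u}
  | succ k ih => rw [pow_succ, ← ih]; exact norm_tmul _ _

/-- Integer tensor powers of a Hermitian line: `Lᵏ = L ⊗ ⋯ ⊗ L` for `k > 0`, `L⁰` is trivial, and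
`L⁻ᵏ = (L*)ᵏ`. -/
def zpow (L : HermitianLine.{u}) : ℤ → HermitianLine.{u}
  | Int.ofNat k => L.npow k
  | Int.negSucc k => L.dual.npow (k + 1)

/-- The tensor powers of a unit vector; negative powers are powers of the dual vector. -/
def zpowVec {L : HermitianLine.{u}} (s : L) : (k : ℤ) → L.zpow k
  | Int.ofNat k => npowVec s k
  | Int.negSucc k => npowVec (dualVec s) (k + 1)

theorem norm_zpowVec {L : HermitianLine.{u}} {s : L} (hs : ‖s‖ = 1) (k : ℤ) :
    ‖zpowVec s k‖ = 1 := by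
  cases k with
  | ofNat k => exact (norm_npowVec s k).trans (by simp [hs])
  | negSucc k => exact (norm_npowVec (dualVec s) (k + 1)).trans (by simp [norm_dualVec, hs])

theorem norm_inner_eq_one {L : HermitianLine.{u}} {s t : L} (hs : ‖s‖ = 1) (ht : ‖t‖ = 1) :
    ‖⟪s, t⟫_ℂ‖ = 1 := by
  have := congrArg norm (eq_smul hs t)
  rw [norm_smul, hs, ht, mul_one] at this
  exact this.symm

theorem inner_zpowVec {L : HermitianLine.{u}} {s t : L} (hs : ‖s‖ = 1) (ht : ‖t‖ = 1) (k : ℤ) :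
    ⟪zpowVec s k, zpowVec t k⟫_ℂ = ⟪s, t⟫_ℂ ^ k := by
  cases k with
  | ofNat k => exact (inner_npowVec s t k).trans (by simp)
  | negSucc k =>
    refine (inner_npowVec (dualVec s) (dualVec t) (k + 1)).trans ?_
    rw [inner_dualVec, zpow_negSucc, ← inv_pow,
      Complex.inv_eq_conj (norm_inner_eq_one hs ht)]

theorem zpowVec_smul {L : HermitianLine.{u}} {s : L} (hs : ‖s‖ = 1) {c : ℂ} (hc : ‖c‖ = 1)
    (k : ℤ) : zpowVec (c • s) k = c ^ k • zpowVec s k := by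
  have h := eq_smul (norm_zpowVec hs k) (zpowVec (c • s) k)
  rwa [inner_zpowVec hs (by rw [norm_smul, hc, hs, one_mul]), inner_smul_right,
    inner_self_eq_norm_sq_to_K, hs, RCLike.ofReal_one, one_pow, mul_one] at h

/-- The canonical isomorphism `Lᵐ ⊗ Lⁿ ≃ Lᵏ` for `m + n = k`, induced by concatenation of tensors
and by the contraction of `L` with its dual: it is the unique unitary map with
`sᵐ ⊗ sⁿ ↦ sᵏ` for all unit vectors `s` (see `zpowMul_apply`). -/
def zpowMul (L : HermitianLine.{u}) {m n k : ℤ} (_ : m + n = k) :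
    ((L.zpow m).tensor (L.zpow n)) ≃ₗᵢ[ℂ] (L.zpow k) :=
  unitaryOfUnit
    (s := tmul (zpowVec L.exists_unit.choose m) (zpowVec L.exists_unit.choose n))
    (t := zpowVec L.exists_unit.choose k)
    (by rw [norm_tmul, norm_zpowVec L.exists_unit.choose_spec,
      norm_zpowVec L.exists_unit.choose_spec, one_mul])
    (norm_zpowVec L.exists_unit.choose_spec k)

theorem zpowMul_apply (L : HermitianLine.{u}) {m n k : ℤ} (h : m + n = k) {s : L}
    (hs : ‖s‖ = 1) : L.zpowMul h (tmul (zpowVec s m) (zpowVec s n)) = zpowVec s k := by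
  have hs' := L.exists_unit.choose_spec
  have hc := norm_inner_eq_one hs' hs
  have e : s = ⟪L.exists_unit.choose, s⟫_ℂ • L.exists_unit.choose := eq_smul hs' s
  have hc0 : ⟪L.exists_unit.choose, s⟫_ℂ ≠ 0 := by
    intro h0; rw [h0] at hc; simp at hc
  generalize ⟪L.exists_unit.choose, s⟫_ℂ = c at *
  rw [e, zpowVec_smul hs' hc, zpowVec_smul hs' hc, zpowVec_smul hs' hc]
  have : tmul (c ^ m • zpowVec L.exists_unit.choose m) (c ^ n • zpowVec L.exists_unit.choose n)
      = c ^ k • tmul (zpowVec L.exists_unit.choose m) (zpowVec L.exists_unit.choose n) := by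
    rw [← h, zpow_add₀ hc0]
    exact TensorProduct.smul_tmul_smul _ _ _ _
  rw [this, map_smul, zpowMul, unitaryOfUnit_apply]

/-- A unitary isomorphism `A ⊗ B ≃ C` as a linear map on the algebraic tensor product. -/
def ofTensor {A B C : HermitianLine.{u}} (μ : (A.tensor B) ≃ₗᵢ[ℂ] C) : A ⊗[ℂ] B →ₗ[ℂ] C where
  toFun x := μ x
  map_add' := μ.map_add
  map_smul' := μ.map_smul

/-- The inverse of a unitary isomorphism `A ⊗ B ≃ C` as a linear map to the algebraic tensor
product. -/
def toTensor {A B C : HermitianLine.{u}} (μ : (A.tensor B) ≃ₗᵢ[ℂ] C) : C →ₗ[ℂ] A ⊗[ℂ] B where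
  toFun x := μ.symm x
  map_add' := μ.symm.map_add
  map_smul' := μ.symm.map_smul

/-- The multiplication `ℂ ⊗ ℂ ≃ ℂ` of the trivial line, with `1 ⊗ 1 ↦ 1`. -/
def trivialMul : (trivial.{u}.tensor trivial) ≃ₗᵢ[ℂ] trivial.{u} :=
  unitaryOfUnit (s := tmul one one) (t := one)
    (by rw [norm_tmul, norm_one.{u}, one_mul]) norm_one.{u}

theorem trivialMul_apply : trivialMul.{u} (tmul one one) = one := unitaryOfUnit_apply _ _

/-- Given `μ : A ⊗ B ≃ C` and `μ' : A' ⊗ B' ≃ C'`, the map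
`(A ⊗ A') ⊗ (B ⊗ B') ≃ C ⊗ C'`, `(a ⊗ a') ⊗ (b ⊗ b') ↦ μ (a ⊗ b) ⊗ μ' (a' ⊗ b')`. -/
def tensorMul {A B C A' B' C' : HermitianLine.{u}} (μ : (A.tensor B) ≃ₗᵢ[ℂ] C)
    (μ' : (A'.tensor B') ≃ₗᵢ[ℂ] C') :
    ((A.tensor A').tensor (B.tensor B')) ≃ₗᵢ[ℂ] (C.tensor C') :=
  unitaryOfLinear
    (L := (A.tensor A').tensor (B.tensor B')) (K := C.tensor C')
    (TensorProduct.map (ofTensor μ) (ofTensor μ') ∘ₗ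
      (TensorProduct.tensorTensorTensorComm ℂ A A' B B').toLinearMap)
    (by
      obtain ⟨a, ha⟩ := A.exists_unit
      obtain ⟨b, hb⟩ := B.exists_unit
      obtain ⟨a', ha'⟩ := A'.exists_unit
      obtain ⟨b', hb'⟩ := B'.exists_unit
      refine ⟨tmul (tmul a a') (tmul b b'), by simp [norm_tmul, *], ?_⟩
      change ‖tmul (μ (tmul a b)) (μ' (tmul a' b'))‖ = 1
      simp [norm_tmul, *])

theorem tensorMul_apply {A B C A' B' C' : HermitianLine.{u}} (μ : (A.tensor B) ≃ₗᵢ[ℂ] C)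
    (μ' : (A'.tensor B') ≃ₗᵢ[ℂ] C') (a : A) (a' : A') (b : B) (b' : B') :
    tensorMul μ μ' (tmul (tmul a a') (tmul b b')) = tmul (μ (tmul a b)) (μ' (tmul a' b')) :=
  rfl

/-- For `μ : A ⊗ B ≃ C`, the linear map `A* ⊗ B* → C*`, `φ ⊗ ψ ↦ (φ ⊗ ψ) ∘ μ⁻¹`. -/
def dualMulLinear {A B C : HermitianLine.{u}} (μ : (A.tensor B) ≃ₗᵢ[ℂ] C) :
    StrongDual ℂ A ⊗[ℂ] StrongDual ℂ B →ₗ[ℂ] StrongDual ℂ C :=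
  (LinearMap.toContinuousLinearMap (𝕜 := ℂ) (E := C) (F' := ℂ)).toLinearMap ∘ₗ
    LinearMap.lcomp ℂ ℂ (toTensor μ) ∘ₗ
    TensorProduct.dualDistrib ℂ A B ∘ₗ
    TensorProduct.map (ContinuousLinearMap.coeLM ℂ) (ContinuousLinearMap.coeLM ℂ)

theorem dualMulLinear_apply {A B C : HermitianLine.{u}} (μ : (A.tensor B) ≃ₗᵢ[ℂ] C) (a : A)
    (b : B) : dualMulLinear μ (InnerProductSpace.toDual ℂ A a ⊗ₜ InnerProductSpace.toDual ℂ B b) =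
      InnerProductSpace.toDual ℂ C (μ (tmul a b)) := by
  refine ContinuousLinearMap.ext fun z => ?_
  obtain ⟨x, rfl⟩ := μ.surjective z
  rw [InnerProductSpace.toDual_apply_apply, LinearIsometryEquiv.inner_map_map]
  have h : toTensor μ (μ x) = x := μ.symm_apply_apply x
  simp only [dualMulLinear, LinearMap.coe_comp, Function.comp_apply, LinearEquiv.coe_coe,
    LinearMap.coe_toContinuousLinearMap', LinearMap.lcomp_apply, TensorProduct.map_tmul, h]
  change TensorProduct.dualDistrib ℂ A B _ x = ⟪(a ⊗ₜ[ℂ] b : A ⊗[ℂ] B), x⟫_ℂ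
  refine TensorProduct.induction_on (motive := fun x : A ⊗[ℂ] B =>
    TensorProduct.dualDistrib ℂ A B _ x = ⟪(a ⊗ₜ[ℂ] b : A ⊗[ℂ] B), x⟫_ℂ) x ?_ ?_ ?_
  · simp
  · intro x y; simp
  · intro x y hx hy; rw [map_add, hx, hy, inner_add_right]

/-- Given `μ : A ⊗ B ≃ C`, the dual isomorphism `A* ⊗ B* ≃ C*`, `φ ⊗ ψ ↦ (φ ⊗ ψ) ∘ μ⁻¹`. -/
def dualMul {A B C : HermitianLine.{u}} (μ : (A.tensor B) ≃ₗᵢ[ℂ] C) :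
    (A.dual.tensor B.dual) ≃ₗᵢ[ℂ] C.dual :=
  unitaryOfLinear (L := A.dual.tensor B.dual) (K := C.dual) (dualMulLinear μ)
    (by
      obtain ⟨a, ha⟩ := A.exists_unit
      obtain ⟨b, hb⟩ := B.exists_unit
      refine ⟨tmul (dualVec a) (dualVec b), by simp [norm_tmul, norm_dualVec, *], ?_⟩
      refine (congrArg norm (dualMulLinear_apply μ a b)).trans ?_
      exact (norm_dualVec _).trans (by rw [μ.norm_map, norm_tmul, ha, hb, one_mul]))

theorem dualMul_apply {A B C : HermitianLine.{u}} (μ : (A.tensor B) ≃ₗᵢ[ℂ] C) (a : A) (b : B) :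
    dualMul μ (tmul (dualVec a) (dualVec b)) = dualVec (μ (tmul a b)) :=
  dualMulLinear_apply μ a b

/-- The bilinear contraction `(b ⊗ α, c ⊗ β) ↦ β b • (c ⊗ α)`. -/
def contractLinear (A B C : HermitianLine.{u}) :
    B ⊗[ℂ] StrongDual ℂ A →ₗ[ℂ] C ⊗[ℂ] StrongDual ℂ B →ₗ[ℂ] C ⊗[ℂ] StrongDual ℂ A :=
  ((TensorProduct.map₂
      ((ContinuousLinearMap.coeLM ℂ : StrongDual ℂ B →ₗ[ℂ] (B →ₗ[ℂ] ℂ)).flip)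
      ((TensorProduct.mk ℂ C (StrongDual ℂ A)).flip)).compr₂
        (TensorProduct.lid ℂ (C ⊗[ℂ] StrongDual ℂ A)).toLinearMap).compl₂
          (TensorProduct.comm ℂ C (StrongDual ℂ B)).toLinearMap

/-- The contraction `(B ⊗ A*) × (C ⊗ B*) → C ⊗ A*`, `(b ⊗ α, c ⊗ β) ↦ β b • (c ⊗ α)`. -/
def contract {A B C : HermitianLine.{u}} (x : B.tensor A.dual) (y : C.tensor B.dual) :
    C.tensor A.dual :=
  contractLinear A B C x y

theorem contract_apply {A B C : HermitianLine.{u}} (b : B) (α : A.dual) (c : C)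
    (β : StrongDual ℂ B) :
    contract (tmul b α) (tmul (K := B.dual) c β) = β b • tmul c α :=
  rfl

/-- Associativity of unitary multiplications of Hermitian lines can be tested on unit vectors. -/
theorem assoc_of_unit {A B C D E F : HermitianLine.{u}} (μ : (A.tensor B) ≃ₗᵢ[ℂ] D)
    (ν : (D.tensor C) ≃ₗᵢ[ℂ] F) (μ' : (B.tensor C) ≃ₗᵢ[ℂ] E) (ν' : (A.tensor E) ≃ₗᵢ[ℂ] F)
    {a₀ : A} {b₀ : B} {c₀ : C} (ha : ‖a₀‖ = 1) (hb : ‖b₀‖ = 1) (hc : ‖c₀‖ = 1)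
    (h : ν (tmul (μ (tmul a₀ b₀)) c₀) = ν' (tmul a₀ (μ' (tmul b₀ c₀)))) (a : A) (b : B) (c : C) :
    ν (tmul (μ (tmul a b)) c) = ν' (tmul a (μ' (tmul b c))) := by
  have smul_l : ∀ {P Q : HermitianLine.{u}} (r : ℂ) (x : P) (y : Q),
      tmul (r • x) y = r • tmul x y := fun r x y => TensorProduct.smul_tmul' r x y
  have smul_r : ∀ {P Q : HermitianLine.{u}} (r : ℂ) (x : P) (y : Q),
      tmul x (r • y) = r • tmul x y := fun r x y => TensorProduct.tmul_smul r x y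
  rw [eq_smul ha a, eq_smul hb b, eq_smul hc c]
  simp only [smul_l, smul_r, map_smul, h]

end HermitianLine

/-! ## Hermitian line bundles -/

/-- A local section of unit length of a family of Hermitian lines, defined on an open set (its
values outside of the domain are irrelevant). -/
structure UnitFrame {B : SmoothSpace.{v}} (F : B → HermitianLine.{u}) where
  domain : Set B
  isOpen_domain : IsOpen domain
  vec : ∀ b, F b
  norm_vec : ∀ b ∈ domain, ‖vec b‖ = 1

/-- A smooth Hermitian line bundle over `B`: a family of Hermitian lines together with an atlas of
local unitary trivialisations, given by local unit frames. Any two of them differ by a smooth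
`U(1)`-valued transition function, `t = ⟪s, t⟫ s`. -/
structure HermitianLineBundle (B : SmoothSpace.{v}) where
  fiber : B → HermitianLine.{u}
  frames : Set (UnitFrame fiber)
  exists_frame : ∀ b, ∃ s ∈ frames, b ∈ s.domain
  smooth_transition : ∀ s ∈ frames, ∀ t ∈ frames,
    SmoothSpace.SmoothOn (fun b => ⟪s.vec b, t.vec b⟫_ℂ) (s.domain ∩ t.domain)

namespace HermitianLineBundle

open HermitianLine

variable {B : SmoothSpace.{v}} {B' : SmoothSpace.{w}}

/-- An isomorphism of Hermitian line bundles over `B`: fibrewise unitary isomorphisms with smooth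
coefficients in local unit frames. -/
structure Iso (L K : HermitianLineBundle.{u} B) where
  map : ∀ b, (L.fiber b) ≃ₗᵢ[ℂ] (K.fiber b)
  smooth : ∀ s ∈ L.frames, ∀ t ∈ K.frames,
    SmoothSpace.SmoothOn (fun b => ⟪t.vec b, map b (s.vec b)⟫_ℂ) (s.domain ∩ t.domain)

/-- The pullback of a Hermitian line bundle. -/
def pullback (L : HermitianLineBundle.{u} B) (q : SmoothMap B' B) :
    HermitianLineBundle.{u} B' where
  fiber b := L.fiber (q b)
  frames := (fun s : UnitFrame L.fiber =>
    { domain := q ⁻¹' s.domain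
      isOpen_domain := s.isOpen_domain.preimage q.continuous
      vec := fun b => s.vec (q b)
      norm_vec := fun b hb => s.norm_vec (q b) hb }) '' L.frames
  exists_frame b := by
    obtain ⟨s, hs, hb⟩ := L.exists_frame (q b)
    exact ⟨_, ⟨s, hs, rfl⟩, hb⟩
  smooth_transition := by
    rintro _ ⟨s, hs, rfl⟩ _ ⟨t, ht, rfl⟩
    exact (L.smooth_transition s hs t ht).comp q

/-- The tensor product of Hermitian line bundles. -/
def tensor (L K : HermitianLineBundle.{u} B) : HermitianLineBundle.{u} B where
  fiber b := (L.fiber b).tensor (K.fiber b)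
  frames := Set.image2 (fun (s : UnitFrame L.fiber) (t : UnitFrame K.fiber) =>
    { domain := s.domain ∩ t.domain
      isOpen_domain := s.isOpen_domain.inter t.isOpen_domain
      vec := fun b => tmul (s.vec b) (t.vec b)
      norm_vec := fun b hb => by
        rw [norm_tmul, s.norm_vec b hb.1, t.norm_vec b hb.2, one_mul] }) L.frames K.frames
  exists_frame b := by
    obtain ⟨s, hs, hb⟩ := L.exists_frame b
    obtain ⟨t, ht, hb'⟩ := K.exists_frame b
    exact ⟨_, ⟨s, hs, t, ht, rfl⟩, hb, hb'⟩
  smooth_transition := by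
    rintro _ ⟨s, hs, t, ht, rfl⟩ _ ⟨s', hs', t', ht', rfl⟩
    exact ((L.smooth_transition s hs s' hs').mono fun b hb => ⟨hb.1.1, hb.2.1⟩).mul
      ((K.smooth_transition t ht t' ht').mono fun b hb => ⟨hb.1.2, hb.2.2⟩)

/-- The dual of a Hermitian line bundle. -/
def dual (L : HermitianLineBundle.{u} B) : HermitianLineBundle.{u} B where
  fiber b := (L.fiber b).dual
  frames := (fun s : UnitFrame L.fiber =>
    { domain := s.domain
      isOpen_domain := s.isOpen_domain
      vec := fun b => dualVec (s.vec b)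
      norm_vec := fun b hb => by rw [norm_dualVec, s.norm_vec b hb] }) '' L.frames
  exists_frame b := by
    obtain ⟨s, hs, hb⟩ := L.exists_frame b
    exact ⟨_, ⟨s, hs, rfl⟩, hb⟩
  smooth_transition := by
    rintro _ ⟨s, hs, rfl⟩ _ ⟨t, ht, rfl⟩
    exact (L.smooth_transition s hs t ht).conj.congr fun b _ => inner_dualVec _ _

/-- The trivial Hermitian line bundle. -/
def trivial (B : SmoothSpace.{v}) : HermitianLineBundle.{u} B where
  fiber _ := HermitianLine.trivial
  frames := {{ domain := Set.univ
               isOpen_domain := isOpen_univ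
               vec := fun _ => HermitianLine.one
               norm_vec := fun _ _ => HermitianLine.norm_one.{u} }}
  exists_frame b := ⟨_, rfl, Set.mem_univ b⟩
  smooth_transition := by
    rintro _ rfl _ rfl
    exact SmoothSpace.SmoothOn.const ⟪HermitianLine.one.{u}, HermitianLine.one.{u}⟫_ℂ

/-- For a locally constant function `h : B → ℤ`, the Hermitian line bundle `Lʰ` with fibre
`(L_b)^{h(b)}` at `b`. -/
def zpow (L : HermitianLineBundle.{u} B) (h : B → ℤ) (hh : IsLocallyConstant h) :
    HermitianLineBundle.{u} B where
  fiber b := (L.fiber b).zpow (h b)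
  frames := (fun s : UnitFrame L.fiber =>
    { domain := s.domain
      isOpen_domain := s.isOpen_domain
      vec := fun b => zpowVec (s.vec b) (h b)
      norm_vec := fun b hb => norm_zpowVec (s.norm_vec b hb) _ }) '' L.frames
  exists_frame b := by
    obtain ⟨s, hs, hb⟩ := L.exists_frame b
    exact ⟨_, ⟨s, hs, rfl⟩, hb⟩
  smooth_transition := by
    rintro _ ⟨s, hs, rfl⟩ _ ⟨t, ht, rfl⟩
    refine SmoothSpace.SmoothOn.locallyConstant
      (F := fun k b => ⟪zpowVec (s.vec b) k, zpowVec (t.vec b) k⟫_ℂ) (fun k => ?_) hh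
    have hst := L.smooth_transition s hs t ht
    cases k with
    | ofNat k => exact (hst.pow k).congr fun b _ => inner_npowVec _ _ _
    | negSucc k =>
      exact (hst.conj.pow (k + 1)).congr fun b _ =>
        (inner_npowVec _ _ _).trans (by rw [inner_dualVec])

/-- The tensor product `⨂ᵢ Lᵢ` of a finite family of Hermitian line bundles (the empty product is
the trivial bundle). -/
def tensorFamily : {n : ℕ} → (Fin n → HermitianLineBundle.{u} B) → HermitianLineBundle.{u} B
  | 0, _ => trivial B
  | _ + 1, L => (tensorFamily fun i => L i.castSucc).tensor (L (Fin.last _))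

/-- The canonical isomorphism `(L_b)ᵐ ⊗ (L_{b'})ⁿ ≃ (L_b)ᵏ` for `b = b'` and `m + n = k`. -/
def zpowMul (L : HermitianLineBundle.{u} B) {b b' : B} (h : b = b') {m n k : ℤ}
    (hk : m + n = k) :
    (((L.fiber b).zpow m).tensor ((L.fiber b').zpow n)) ≃ₗᵢ[ℂ] ((L.fiber b).zpow k) :=
  match b', h with
  | _, rfl => (L.fiber b).zpowMul hk

theorem zpowMul_apply (L : HermitianLineBundle.{u} B) {b b' : B} (h : b = b') {m n k : ℤ}
    (hk : m + n = k) (s : ∀ b, L.fiber b) (hs : ‖s b‖ = 1) :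
    L.zpowMul h hk (tmul (zpowVec (s b) m) (zpowVec (s b') n)) = zpowVec (s b) k := by
  subst h
  exact (L.fiber b).zpowMul_apply hk hs

theorem inner_zpowMul (L : HermitianLineBundle.{u} B) {b b' : B} (h : b = b') {m n k : ℤ}
    (hk : m + n = k) (s : ∀ b, L.fiber b) (hs : ‖s b‖ = 1) (x : (L.fiber b).zpow m)
    (y : (L.fiber b').zpow n) :
    ⟪zpowVec (s b) k, L.zpowMul h hk (tmul x y)⟫_ℂ =
      ⟪zpowVec (s b) m, x⟫_ℂ * ⟪zpowVec (s b') n, y⟫_ℂ := by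
  rw [← L.zpowMul_apply h hk s hs, LinearIsometryEquiv.inner_map_map, inner_tmul]

end HermitianLineBundle

/-! ## Fibre products -/

section FiberProduct

variable {X : SmoothSpace.{u}} {Y : SmoothSpace.{v}} {M : SmoothSpace.{w}}

/-- The fibre product `Y ×_M X`. -/
def fiberProduct (π : SmoothMap Y M) (π' : SmoothMap X M) : SmoothSpace.{max u v} :=
  (Y.prod X).sub {p : Y × X | π p.1 = π' p.2}

namespace fiberProduct

def fst (π : SmoothMap Y M) (π' : SmoothMap X M) : SmoothMap (fiberProduct π π') Y :=
  (SmoothMap.fst Y X).comp (SmoothMap.incl _ _)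

def snd (π : SmoothMap Y M) (π' : SmoothMap X M) : SmoothMap (fiberProduct π π') X :=
  (SmoothMap.snd Y X).comp (SmoothMap.incl _ _)

/-- The canonical map `Y ×_M X → M`. -/
def proj (π : SmoothMap Y M) (π' : SmoothMap X M) : SmoothMap (fiberProduct π π') M :=
  π.comp (fst π π')

end fiberProduct

/-- The twofold fibre product `Y^[2]`. -/
abbrev pairs (π : SmoothMap Y M) : SmoothSpace.{v} := fiberProduct π π

/-- The threefold fibre product `Y^[3]`. -/
def triples (π : SmoothMap Y M) : SmoothSpace.{v} :=
  (Y.prod (Y.prod Y)).sub {t : Y × Y × Y | π t.1 = π t.2.1 ∧ π t.2.1 = π t.2.2}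

/-- `π₁ : Y^[2] → Y`, `(y₁, y₂) ↦ y₂`. -/
def pairs.face₁ (π : SmoothMap Y M) : SmoothMap (pairs π) Y := fiberProduct.snd π π

/-- `π₂ : Y^[2] → Y`, `(y₁, y₂) ↦ y₁`. -/
def pairs.face₂ (π : SmoothMap Y M) : SmoothMap (pairs π) Y := fiberProduct.fst π π

namespace triples

def coord₁ (π : SmoothMap Y M) : SmoothMap (triples π) Y :=
  (SmoothMap.fst _ _).comp (SmoothMap.incl _ _)

def coord₂ (π : SmoothMap Y M) : SmoothMap (triples π) Y :=
  (SmoothMap.fst _ _).comp ((SmoothMap.snd _ _).comp (SmoothMap.incl _ _))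

def coord₃ (π : SmoothMap Y M) : SmoothMap (triples π) Y :=
  (SmoothMap.snd _ _).comp ((SmoothMap.snd _ _).comp (SmoothMap.incl _ _))

/-- `π₁ : Y^[3] → Y^[2]`, `(y₁, y₂, y₃) ↦ (y₂, y₃)`. -/
def face₁ (π : SmoothMap Y M) : SmoothMap (triples π) (pairs π) :=
  ((coord₂ π).prodMk (coord₃ π)).codRestrict _ fun t => t.2.2

/-- `π₂ : Y^[3] → Y^[2]`, `(y₁, y₂, y₃) ↦ (y₁, y₃)`. -/
def face₂ (π : SmoothMap Y M) : SmoothMap (triples π) (pairs π) :=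
  ((coord₁ π).prodMk (coord₃ π)).codRestrict _ fun t => t.2.1.trans t.2.2

/-- `π₃ : Y^[3] → Y^[2]`, `(y₁, y₂, y₃) ↦ (y₁, y₂)`. -/
def face₃ (π : SmoothMap Y M) : SmoothMap (triples π) (pairs π) :=
  ((coord₁ π).prodMk (coord₂ π)).codRestrict _ fun t => t.2.1

end triples

/-- `δ(h) = h ∘ π₁ - h ∘ π₂` for `h : Y → ℤ`. -/
def delta₁ (π : SmoothMap Y M) (h : Y → ℤ) : pairs π → ℤ :=
  fun p => h (pairs.face₁ π p) - h (pairs.face₂ π p)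

/-- `δ(g) = g ∘ π₁ - g ∘ π₂ + g ∘ π₃` for `g : Y^[2] → ℤ`. -/
def delta₂ (π : SmoothMap Y M) (g : pairs π → ℤ) : triples π → ℤ :=
  fun t => g (triples.face₁ π t) - g (triples.face₂ π t) + g (triples.face₃ π t)

/-- The map `f^[2] : X^[2] → Y^[2]` induced by a map `f : X → Y` over `M`. -/
def pairs.map {π : SmoothMap Y M} {π' : SmoothMap X M} (f : SmoothMap X Y)
    (hf : ∀ x, π (f x) = π' x) : SmoothMap (pairs π') (pairs π) :=
  ((f.comp (pairs.face₂ π')).prodMk (f.comp (pairs.face₁ π'))).codRestrict _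
    fun p => (hf p.1.1).trans (p.2.trans (hf p.1.2).symm)

/-- The map `f^[3] : X^[3] → Y^[3]` induced by a map `f : X → Y` over `M`. -/
def triples.map {π : SmoothMap Y M} {π' : SmoothMap X M} (f : SmoothMap X Y)
    (hf : ∀ x, π (f x) = π' x) : SmoothMap (triples π') (triples π) :=
  ((f.comp (triples.coord₁ π')).prodMk
    ((f.comp (triples.coord₂ π')).prodMk (f.comp (triples.coord₃ π')))).codRestrict _
    fun t => ⟨(hf t.1.1).trans (t.2.1.trans (hf t.1.2.1).symm),
      (hf t.1.2.1).trans (t.2.2.trans (hf t.1.2.2).symm)⟩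

end FiberProduct

/-! ## Bundle gerbes -/

section BundleGerbe

open HermitianLine

variable {X : SmoothSpace.{u}} {Y : SmoothSpace.{v}} {M : SmoothSpace.{w}}

/-- The component `P_(y₁, y₂) ⊗ P_(y₂, y₃) ≃ P_(y₁, y₃)` of a bundle gerbe multiplication
`π₃⁻¹(P) ⊗ π₁⁻¹(P) ≃ π₂⁻¹(P)`. -/
def mulAt {π : SmoothMap Y M} {P : HermitianLineBundle.{l} (pairs π)}
    (μ : HermitianLineBundle.Iso
      ((P.pullback (triples.face₃ π)).tensor (P.pullback (triples.face₁ π)))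
      (P.pullback (triples.face₂ π)))
    {y₁ y₂ y₃ : Y} (h₁₂ : π y₁ = π y₂) (h₂₃ : π y₂ = π y₃) :
    ((P.fiber ⟨(y₁, y₂), h₁₂⟩).tensor (P.fiber ⟨(y₂, y₃), h₂₃⟩)) ≃ₗᵢ[ℂ]
      (P.fiber ⟨(y₁, y₃), h₁₂.trans h₂₃⟩) :=
  μ.map ⟨(y₁, y₂, y₃), h₁₂, h₂₃⟩

/-- A bundle gerbe `(P, Y)` over `M`: a Hermitian line bundle `P` over `Y^[2]` with an associative
multiplication. (The map `π` will always be a surjective submersion.) -/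
structure BundleGerbe (π : SmoothMap Y M) where
  bundle : HermitianLineBundle.{l} (pairs π)
  mul : HermitianLineBundle.Iso
    ((bundle.pullback (triples.face₃ π)).tensor (bundle.pullback (triples.face₁ π)))
    (bundle.pullback (triples.face₂ π))
  assoc : ∀ {y₁ y₂ y₃ y₄ : Y} (h₁₂ : π y₁ = π y₂) (h₂₃ : π y₂ = π y₃) (h₃₄ : π y₃ = π y₄)
    (a : bundle.fiber ⟨(y₁, y₂), h₁₂⟩) (b : bundle.fiber ⟨(y₂, y₃), h₂₃⟩)
    (c : bundle.fiber ⟨(y₃, y₄), h₃₄⟩),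
    mulAt mul (h₁₂.trans h₂₃) h₃₄ (tmul (mulAt mul h₁₂ h₂₃ (tmul a b)) c) =
      mulAt mul h₁₂ (h₂₃.trans h₃₄) (tmul a (mulAt mul h₂₃ h₃₄ (tmul b c)))

namespace BundleGerbe

variable {π : SmoothMap Y M} {π' : SmoothMap X M}

/-- The pullback of a bundle gerbe by a map `f : X → Y` over `M`. -/
def pullback (P : BundleGerbe.{l} π) (f : SmoothMap X Y) (hf : ∀ x, π (f x) = π' x) :
    BundleGerbe.{l} π' where
  bundle := P.bundle.pullback (pairs.map f hf)
  mul :=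
    { map := fun t => P.mul.map (triples.map f hf t)
      smooth := by
        rintro _ ⟨_, ⟨_, ⟨s, hs, rfl⟩, rfl⟩, _, ⟨_, ⟨t, ht, rfl⟩, rfl⟩, rfl⟩
          _ ⟨_, ⟨r, hr, rfl⟩, rfl⟩
        exact (P.mul.smooth _ ⟨_, ⟨s, hs, rfl⟩, _, ⟨t, ht, rfl⟩, rfl⟩ _ ⟨r, hr, rfl⟩).comp
          (triples.map f hf) }
  assoc := by
    intro y₁ y₂ y₃ y₄ h₁₂ h₂₃ h₃₄ a b c
    exact P.assoc (y₁ := f y₁) (y₂ := f y₂) (y₃ := f y₃) (y₄ := f y₄) _ _ _ a b c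

/-- The dual bundle gerbe `(P*, Y)`. -/
def dual (P : BundleGerbe.{l} π) : BundleGerbe.{l} π where
  bundle := P.bundle.dual
  mul :=
    { map := fun t => dualMul (P.mul.map t)
      smooth := by
        rintro _ ⟨_, ⟨_, ⟨s, hs, rfl⟩, rfl⟩, _, ⟨_, ⟨t, ht, rfl⟩, rfl⟩, rfl⟩
          _ ⟨_, ⟨r, hr, rfl⟩, rfl⟩
        refine (P.mul.smooth _ ⟨_, ⟨s, hs, rfl⟩, _, ⟨t, ht, rfl⟩, rfl⟩
          _ ⟨r, hr, rfl⟩).conj.congr fun z _ => ?_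
        exact (congrArg _ (dualMul_apply _ _ _)).trans (inner_dualVec _ _) }
  assoc := by
    intro y₁ y₂ y₃ y₄ h₁₂ h₂₃ h₃₄
    obtain ⟨a, ha⟩ := (P.bundle.fiber ⟨(y₁, y₂), h₁₂⟩).exists_unit
    obtain ⟨b, hb⟩ := (P.bundle.fiber ⟨(y₂, y₃), h₂₃⟩).exists_unit
    obtain ⟨c, hc⟩ := (P.bundle.fiber ⟨(y₃, y₄), h₃₄⟩).exists_unit
    refine assoc_of_unit (dualMul (mulAt P.mul h₁₂ h₂₃)) (dualMul (mulAt P.mul _ h₃₄))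
      (dualMul (mulAt P.mul h₂₃ h₃₄)) (dualMul (mulAt P.mul h₁₂ _))
      (a₀ := dualVec a) (b₀ := dualVec b) (c₀ := dualVec c)
      (by rw [norm_dualVec, ha]) (by rw [norm_dualVec, hb]) (by rw [norm_dualVec, hc]) ?_
    rw [dualMul_apply, dualMul_apply, dualMul_apply, dualMul_apply, P.assoc]

/-- The reduced product `(P ⊗_R Q, Y)`: the bundle gerbe with fibre
`P_(y₁, y₂) ⊗ Q_(y₁, y₂)` over `(y₁, y₂)`. -/
def reducedProduct (P Q : BundleGerbe.{l} π) : BundleGerbe.{l} π where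
  bundle := P.bundle.tensor Q.bundle
  mul :=
    { map := fun t => tensorMul (P.mul.map t) (Q.mul.map t)
      smooth := by
        rintro _ ⟨_, ⟨_, ⟨s, hs, s', hs', rfl⟩, rfl⟩, _, ⟨_, ⟨t, ht, t', ht', rfl⟩, rfl⟩, rfl⟩
          _ ⟨_, ⟨r, hr, r', hr', rfl⟩, rfl⟩
        refine (((P.mul.smooth _ ⟨_, ⟨s, hs, rfl⟩, _, ⟨t, ht, rfl⟩, rfl⟩ _ ⟨r, hr, rfl⟩).mono
            fun z hz => ⟨⟨hz.1.1.1, hz.1.2.1⟩, hz.2.1⟩).mul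
          ((Q.mul.smooth _ ⟨_, ⟨s', hs', rfl⟩, _, ⟨t', ht', rfl⟩, rfl⟩ _ ⟨r', hr', rfl⟩).mono
            fun z hz => ⟨⟨hz.1.1.2, hz.1.2.2⟩, hz.2.2⟩)).congr fun z _ => ?_
        exact (congrArg _ (tensorMul_apply _ _ _ _ _ _)).trans (inner_tmul _ _ _ _) }
  assoc := by
    intro y₁ y₂ y₃ y₄ h₁₂ h₂₃ h₃₄
    obtain ⟨a, ha⟩ := (P.bundle.fiber ⟨(y₁, y₂), h₁₂⟩).exists_unit
    obtain ⟨b, hb⟩ := (P.bundle.fiber ⟨(y₂, y₃), h₂₃⟩).exists_unit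
    obtain ⟨c, hc⟩ := (P.bundle.fiber ⟨(y₃, y₄), h₃₄⟩).exists_unit
    obtain ⟨a', ha'⟩ := (Q.bundle.fiber ⟨(y₁, y₂), h₁₂⟩).exists_unit
    obtain ⟨b', hb'⟩ := (Q.bundle.fiber ⟨(y₂, y₃), h₂₃⟩).exists_unit
    obtain ⟨c', hc'⟩ := (Q.bundle.fiber ⟨(y₃, y₄), h₃₄⟩).exists_unit
    refine assoc_of_unit (tensorMul (mulAt P.mul h₁₂ h₂₃) (mulAt Q.mul h₁₂ h₂₃))
      (tensorMul (mulAt P.mul _ h₃₄) (mulAt Q.mul _ h₃₄))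
      (tensorMul (mulAt P.mul h₂₃ h₃₄) (mulAt Q.mul h₂₃ h₃₄))
      (tensorMul (mulAt P.mul h₁₂ _) (mulAt Q.mul h₁₂ _))
      (a₀ := tmul a a') (b₀ := tmul b b') (c₀ := tmul c c')
      (by rw [norm_tmul, ha, ha', one_mul]) (by rw [norm_tmul, hb, hb', one_mul])
      (by rw [norm_tmul, hc, hc', one_mul]) ?_
    rw [tensorMul_apply, tensorMul_apply, tensorMul_apply, tensorMul_apply, P.assoc, Q.assoc]

/-- The product `(P, Y) ⊗ (Q, X) = (P ⊗ Q, Y ×_M X)`, with fibre `P_(y₁, y₂) ⊗ Q_(x₁, x₂)` over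
`((y₁, x₁), (y₂, x₂))`. -/
def product (P : BundleGerbe.{l} π) (Q : BundleGerbe.{l} π') :
    BundleGerbe.{l} (fiberProduct.proj π π') :=
  (P.pullback (fiberProduct.fst π π') fun _ => rfl).reducedProduct
    (Q.pullback (fiberProduct.snd π π') fun z => (Subtype.property z).symm)

/-- The trivial bundle gerbe, with fibre `ℂ` and multiplication `ℂ ⊗ ℂ = ℂ`. -/
def unit (π : SmoothMap Y M) : BundleGerbe.{l} π where
  bundle := HermitianLineBundle.trivial _
  mul :=
    { map := fun _ => trivialMul
      smooth := by
        rintro _ ⟨_, ⟨_, rfl, rfl⟩, _, ⟨_, rfl, rfl⟩, rfl⟩ _ ⟨_, rfl, rfl⟩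
        exact SmoothSpace.SmoothOn.const ⟪one, trivialMul (tmul one one)⟫_ℂ }
  assoc := by
    intro y₁ y₂ y₃ y₄ h₁₂ h₂₃ h₃₄
    refine assoc_of_unit trivialMul trivialMul trivialMul trivialMul
      HermitianLine.norm_one HermitianLine.norm_one HermitianLine.norm_one ?_
    rw [trivialMul_apply, trivialMul_apply]

/-- The reduced product of a finite family of bundle gerbes (the empty product is the trivial
bundle gerbe). -/
def reducedProductFamily : {n : ℕ} → (Fin n → BundleGerbe.{l} π) → BundleGerbe.{l} π
  | 0, _ => unit π
  | _ + 1, P => (reducedProductFamily fun i => P i.castSucc).reducedProduct (P (Fin.last _))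

/-- The cup product bundle gerbe `(L^g, Y)` of a Hermitian line bundle `L` over `M` and a locally
constant function `g : Y^[2] → ℤ` with `δ(g) = 0`. Its fibre over `(y₁, y₂)` is
`(L_m)^{g(y₁, y₂)}` for `m = π(y₁) = π(y₂)`, and its multiplication is the canonical isomorphism
`(L_m)^{g(y₁, y₂)} ⊗ (L_m)^{g(y₂, y₃)} = (L_m)^{g(y₁, y₃)}`. -/
def cupProduct (π : SmoothMap Y M) (L : HermitianLineBundle.{l} M) (g : pairs π → ℤ)
    (hg : IsLocallyConstant g) (hδ : delta₂ π g = 0) : BundleGerbe.{l} π where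
  bundle := (L.pullback (fiberProduct.proj π π)).zpow g hg
  mul :=
    { map := fun t => L.zpowMul t.2.1
        (by have := congrFun hδ t; simp only [delta₂, Pi.zero_apply] at this; linarith)
      smooth := by
        rintro _ ⟨_, ⟨_, ⟨_, ⟨s, hs, rfl⟩, rfl⟩, rfl⟩, _, ⟨_, ⟨_, ⟨t, ht, rfl⟩, rfl⟩, rfl⟩, rfl⟩
          _ ⟨_, ⟨_, ⟨r, hr, rfl⟩, rfl⟩, rfl⟩
        have hs' := (((L.pullback (fiberProduct.proj π π)).zpow g hg).smooth_transition
          _ ⟨_, ⟨r, hr, rfl⟩, rfl⟩ _ ⟨_, ⟨s, hs, rfl⟩, rfl⟩).comp (triples.face₃ π)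
        have ht' := (((L.pullback (fiberProduct.proj π π)).zpow g hg).smooth_transition
          _ ⟨_, ⟨r, hr, rfl⟩, rfl⟩ _ ⟨_, ⟨t, ht, rfl⟩, rfl⟩).comp (triples.face₁ π)
        refine ((hs'.mono fun z hz => ⟨hz.2, hz.1.1⟩).mul
          (ht'.mono fun z hz => ⟨?_, hz.1.2⟩)).congr fun z hz => ?_
        · have h1 : π z.1.1 ∈ r.domain := hz.2
          rw [z.2.1] at h1
          exact h1
        · exact L.inner_zpowMul z.2.1 _ r.vec (r.norm_vec _ hz.2) _ _ }
  assoc := by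
    intro y₁ y₂ y₃ y₄ h₁₂ h₂₃ h₃₄
    let s : ∀ m, L.fiber m := fun m => (L.fiber m).exists_unit.choose
    have hs : ∀ m, ‖s m‖ = 1 := fun m => (L.fiber m).exists_unit.choose_spec
    have add : ∀ {y₁ y₂ y₃ : Y} (h : π y₁ = π y₂) (h' : π y₂ = π y₃),
        g ⟨(y₁, y₂), h⟩ + g ⟨(y₂, y₃), h'⟩ = g ⟨(y₁, y₃), h.trans h'⟩ := by
      intro y₁ y₂ y₃ h h'
      have := congrFun hδ ⟨(y₁, y₂, y₃), h, h'⟩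
      change g ⟨(y₂, y₃), h'⟩ - g ⟨(y₁, y₃), h.trans h'⟩ + g ⟨(y₁, y₂), h⟩ = 0 at this
      linarith
    refine assoc_of_unit (L.zpowMul h₁₂ (add h₁₂ h₂₃))
      (L.zpowMul (h₁₂.trans h₂₃) (add (h₁₂.trans h₂₃) h₃₄))
      (L.zpowMul h₂₃ (add h₂₃ h₃₄)) (L.zpowMul h₁₂ (add h₁₂ (h₂₃.trans h₃₄)))
      (norm_zpowVec (hs (π y₁)) _) (norm_zpowVec (hs (π y₂)) _) (norm_zpowVec (hs (π y₃)) _) ?_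
    rw [L.zpowMul_apply h₁₂ _ s (hs _), L.zpowMul_apply h₂₃ _ s (hs _),
      L.zpowMul_apply (h₁₂.trans h₂₃) _ s (hs _), L.zpowMul_apply h₁₂ _ s (hs _)]

/-- The general cup product bundle gerbe of line bundles `Lᵢ` over `M` and functions
`gᵢ : Y^[2] → ℤ`: the reduced product of the cup product bundle gerbes `(Lᵢ^gᵢ, Y)`. -/
def generalCupProduct (π : SmoothMap Y M) {n : ℕ} (L : Fin n → HermitianLineBundle.{l} M)
    (g : Fin n → pairs π → ℤ) (hg : ∀ i, IsLocallyConstant (g i))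
    (hδ : ∀ i, delta₂ π (g i) = 0) : BundleGerbe.{l} π :=
  reducedProductFamily fun i => cupProduct π (L i) (g i) (hg i) (hδ i)

/-- A trivialisation of `(P, Y)` with trivialising line bundle `R` over `Y`: an isomorphism of `P`
with `δ(R) = π₁⁻¹(R) ⊗ π₂⁻¹(R)*`, whose fibre over `(y₁, y₂)` is `R_{y₂} ⊗ (R_{y₁})*`, taking the
bundle gerbe multiplication to the contraction
`R_{y₂} ⊗ (R_{y₁})* ⊗ R_{y₃} ⊗ (R_{y₂})* → R_{y₃} ⊗ (R_{y₁})*`. -/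
structure Trivialisation (P : BundleGerbe.{l} π) (R : HermitianLineBundle.{l} Y) where
  iso : HermitianLineBundle.Iso P.bundle
    ((R.pullback (pairs.face₁ π)).tensor (R.pullback (pairs.face₂ π)).dual)
  map_mul : ∀ {y₁ y₂ y₃ : Y} (h₁₂ : π y₁ = π y₂) (h₂₃ : π y₂ = π y₃)
    (a : P.bundle.fiber ⟨(y₁, y₂), h₁₂⟩) (b : P.bundle.fiber ⟨(y₂, y₃), h₂₃⟩),
    iso.map ⟨(y₁, y₃), h₁₂.trans h₂₃⟩ (mulAt P.mul h₁₂ h₂₃ (tmul a b)) =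
      contract (iso.map ⟨(y₁, y₂), h₁₂⟩ a) (iso.map ⟨(y₂, y₃), h₂₃⟩ b)

/-- Stable isomorphism of bundle gerbes over `M`: `(P, Y)* ⊗ (Q, X)` has a trivialisation. -/
def StablyIsomorphic (P : BundleGerbe.{l} π) (Q : BundleGerbe.{l} π') : Prop :=
  ∃ R : HermitianLineBundle.{l} (fiberProduct π π'),
    Nonempty (Trivialisation (P.dual.product Q) R)

end BundleGerbe

end BundleGerbe

/-! ## Surjective submersions -/

/-- A surjective submersion of smooth manifolds. -/
structure SurjectiveSubmersion {E H E' H' : Type*} [NormedAddCommGroup E] [NormedSpace ℝ E]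
    [TopologicalSpace H] (I : ModelWithCorners ℝ E H) (Y : Type u) [TopologicalSpace Y]
    [ChartedSpace H Y] [NormedAddCommGroup E'] [NormedSpace ℝ E'] [TopologicalSpace H']
    (J : ModelWithCorners ℝ E' H') (M : Type v) [TopologicalSpace M] [ChartedSpace H' M] where
  toFun : Y → M
  surjective : Function.Surjective toFun
  isSubmersion : Manifold.IsSubmersion I J ∞ toFun

/-- The underlying smooth map of a surjective submersion. -/
def SurjectiveSubmersion.smoothMap {E H E' H' : Type*} [NormedAddCommGroup E] [NormedSpace ℝ E]
    [TopologicalSpace H] {I : ModelWithCorners ℝ E H} {Y : Type u} [TopologicalSpace Y]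
    [ChartedSpace H Y] [NormedAddCommGroup E'] [NormedSpace ℝ E'] [TopologicalSpace H']
    {J : ModelWithCorners ℝ E' H'} {M : Type v} [TopologicalSpace M] [ChartedSpace H' M]
    [IsManifold I ∞ Y] [IsManifold J ∞ M] (π : SurjectiveSubmersion I Y J M) :
    SmoothMap (SmoothSpace.ofManifold I Y) (SmoothSpace.ofManifold J M) :=
  SmoothMap.ofContMDiff π.isSubmersion.contMDiff

end

/-! Unit vectors `s i` in the lines `(L i)_m` determine a unit vector in each tensor construction in
play. Over `(z₁, z₂)` in `(X ×_M Y)^[2]` they give `v(s) = (⨂ sᵢ^gᵢ)* ⊗ ⨂ sᵢ^fᵢ` in `Q* ⊗ P`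
(`dualProductVec`) and `w(s) = ⨂ sᵢ^hᵢ(z₂) ⊗ (⨂ sᵢ^hᵢ(z₁))*` in `δ(⨂ Lᵢ^hᵢ)` (`coboundaryVec`).
Rescaling each `sᵢ` by a phase `cᵢ` multiplies `v(s)` by `∏ cᵢ^(fᵢ - gᵢ)` and `w(s)` by `∏
cᵢ^(hᵢ(z₂) - hᵢ(z₁))`. The hypothesis makes these factors equal, so the unitary map `v(s) ↦ w(s)`
does not depend on `s`. This is `dualProductMap_apply`, obtained by comparing the inner products
`⟪v(s), v(t)⟫` and `⟪w(s), w(t)⟫` (`inner_dualProductVec`, `inner_coboundaryVec`).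

Everything else follows from this independence. The map may be defined with an arbitrary, possibly
discontinuous, choice of unit vectors; it is nevertheless smooth, because near any point it can be
computed with smooth local frames (`smoothOn_dualProductMap`). It respects multiplication because
`v(s)` over `(z₁, z₂)` times `v(s)` over `(z₂, z₃)` is `v(s)` over `(z₁, z₃)`
(`mulAt_dualProductVec`), while contracting the corresponding `w(s)` pairs `⨂ sᵢ^hᵢ(z₂)` with its
own dual vector, giving `1` (`contract_dualVec`).

Stable isomorphism of `P` with `Q` concerns `P* ⊗ Q` over `Y ×_M X`: it is the same trivialisation
with the two gerbes exchanged and `h` replaced by `-h` composed with the swap. -/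

noncomputable section

/-! ### Unit vectors, phases and contractions in Hermitian lines -/

namespace HermitianLine

theorem dualVec_apply_self {L : HermitianLine.{u}} {s : L} (hs : ‖s‖ = 1) :
    (show StrongDual ℂ L from dualVec s) s = 1 := by
  change ⟪s, s⟫_ℂ = 1
  rw [inner_self_eq_norm_sq_to_K, hs]
  simp

/-- A unit vector pairs to `1` with its dual vector. This is the cancellation at the middle point
`z₂` in the multiplicativity of the trivialisation. -/
theorem contract_dualVec {A B C : HermitianLine.{u}} {b : B} (hb : ‖b‖ = 1) (α : A.dual) (c : C) :
    contract (tmul b α) (tmul c (dualVec b)) = tmul c α := by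
  refine (contract_apply b α c (dualVec b)).trans ?_
  refine (congrArg (· • tmul c α) (dualVec_apply_self hb)).trans ?_
  exact one_smul ℂ (tmul c α)

theorem contract_smul_smul {A B C : HermitianLine.{u}} (c d : ℂ) (x : B.tensor A.dual)
    (y : C.tensor B.dual) : contract (c • x) (d • y) = (c * d) • contract x y := by
  have h₁ := (contractLinear A B C).map_smul c x
  have h₂ := (contractLinear A B C x).map_smul d y
  refine (LinearMap.congr_fun h₁ _).trans ((congrArg (c • ·) h₂).trans ?_)
  exact smul_smul c d (contract x y)

theorem tmul_smul_smul {A B : HermitianLine.{u}} (c d : ℂ) (x : A) (y : B) :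
    tmul (c • x) (d • y) = (c * d) • tmul x y :=
  TensorProduct.smul_tmul_smul _ _ _ _

theorem norm_eq_one_of_inner_self {L : HermitianLine.{u}} {s : L} (h : ⟪s, s⟫_ℂ = 1) :
    ‖s‖ = 1 := by
  have h' := InnerProductSpace.norm_sq_eq_re_inner (𝕜 := ℂ) s
  rw [h] at h'
  exact (pow_eq_one_iff_of_nonneg (norm_nonneg _) two_ne_zero).mp (h'.trans (by simp))

theorem inner_self_eq_one {L : HermitianLine.{u}} {s : L} (h : ‖s‖ = 1) : ⟪s, s⟫_ℂ = 1 := by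
  rw [inner_self_eq_norm_sq_to_K, h]
  simp

/-- The unitary map with `s ↦ t` also takes `s'` to `t'` if the two pairs of unit vectors have the
same inner product. -/
theorem unitaryOfUnit_apply_of_inner_eq {L : HermitianLine.{u}} {K : HermitianLine.{v}} {s s' : L}
    {t t' : K} (hs : ‖s‖ = 1) (ht : ‖t‖ = 1) (h : ⟪s, s'⟫_ℂ = ⟪t, t'⟫_ℂ) :
    unitaryOfUnit hs ht s' = t' := by
  -- In a line, the inner product with a unit vector is the only coordinate, so equal inner products
  -- mean equal coordinates of `s'` and `t'`.
  rw [eq_smul hs s', map_smul, unitaryOfUnit_apply, h, ← eq_smul ht]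

theorem norm_tmul_eq_one {A B : HermitianLine.{u}} {x : A} {y : B} (hx : ‖x‖ = 1) (hy : ‖y‖ = 1) :
    ‖tmul x y‖ = 1 := by
  rw [norm_tmul, hx, hy, one_mul]

theorem norm_dualVec_eq_one {A : HermitianLine.{u}} {x : A} (hx : ‖x‖ = 1) : ‖dualVec x‖ = 1 :=
  (norm_dualVec x).trans hx

/-- Compatibility of unitary maps with multiplication and contraction can be tested on unit
vectors. -/
theorem map_mul_of_unit {A B C R₁ R₂ R₃ : HermitianLine.{u}} (μ : (A.tensor B) ≃ₗᵢ[ℂ] C)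
    (φ : A ≃ₗᵢ[ℂ] (R₂.tensor R₁.dual)) (ψ : B ≃ₗᵢ[ℂ] (R₃.tensor R₂.dual))
    (χ : C ≃ₗᵢ[ℂ] (R₃.tensor R₁.dual)) {a₀ : A} {b₀ : B} (ha : ‖a₀‖ = 1) (hb : ‖b₀‖ = 1)
    (h : χ (μ (tmul a₀ b₀)) = contract (φ a₀) (ψ b₀)) (a : A) (b : B) :
    χ (μ (tmul a b)) = contract (φ a) (ψ b) := by
  rw [eq_smul ha a, eq_smul hb b, tmul_smul_smul, map_smul, map_smul, map_smul, map_smul,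
    contract_smul_smul, h]

end HermitianLine

/-- Conjugation inverts a phase. Dualising a factor therefore negates its exponent, which is the
source of both differences `f - g` and `h(z₂) - h(z₁)`. -/
theorem conj_prod_zpow_mul {ι : Type*} [Fintype ι] (c : ι → ℂ) (hc : ∀ i, ‖c i‖ = 1)
    (a b : ι → ℤ) :
    (starRingEnd ℂ) (∏ i, c i ^ a i) * ∏ i, c i ^ b i = ∏ i, c i ^ (b i - a i) := by
  rw [map_prod, ← Finset.prod_mul_distrib]
  refine Finset.prod_congr rfl fun i _ => ?_
  have h0 : c i ≠ 0 := norm_ne_zero_iff.mp (by rw [hc i]; exact one_ne_zero)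
  rw [map_zpow₀, ← Complex.inv_eq_conj (hc i), zpow_sub₀ h0, inv_zpow, div_eq_inv_mul]

open HermitianLine

/-! ### Frames of finite tensor products of line bundle powers -/

namespace HermitianLineBundle

variable {B : SmoothSpace.{v}}

/-- The elementary tensor `⨂ᵢ xᵢ` in a fibre of `⨂ᵢ Kᵢ`. -/
def tensorFamilyVec : {n : ℕ} → (K : Fin n → HermitianLineBundle.{u} B) → (b : B) →
    (∀ i, (K i).fiber b) → (tensorFamily K).fiber b
  | 0, _, _, _ => one
  | _ + 1, K, b, x =>
    tmul (tensorFamilyVec (fun i => K i.castSucc) b fun i => x i.castSucc) (x (Fin.last _))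

theorem inner_tensorFamilyVec {n : ℕ} (K : Fin n → HermitianLineBundle.{u} B) (b : B)
    (x y : ∀ i, (K i).fiber b) :
    ⟪tensorFamilyVec K b x, tensorFamilyVec K b y⟫_ℂ = ∏ i, ⟪x i, y i⟫_ℂ := by
  induction n with
  | zero =>
    change ⟪(1 : ℂ), (1 : ℂ)⟫_ℂ = _
    simp
  | succ n ih =>
    rw [Fin.prod_univ_castSucc, ← ih]
    exact inner_tmul _ _ _ _

/-- The recursive definition tensors one frame at a time, so the factors are recovered by induction.
The formula for `F.vec` holds at every `b`, also off the domain, since frames are total functions.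
-/
theorem exists_of_mem_frames_tensorFamily {n : ℕ} (K : Fin n → HermitianLineBundle.{u} B)
    (F : UnitFrame (tensorFamily K).fiber) (hF : F ∈ (tensorFamily K).frames) :
    ∃ s : ∀ i, UnitFrame (K i).fiber, (∀ i, s i ∈ (K i).frames) ∧
      (∀ b ∈ F.domain, ∀ i, b ∈ (s i).domain) ∧
      ∀ b, F.vec b = tensorFamilyVec K b fun i => (s i).vec b := by
  induction n with
  | zero =>
    refine ⟨fun i => i.elim0, fun i => i.elim0, fun _ _ i => i.elim0, fun b => ?_⟩
    cases hF
    rfl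
  | succ n ih =>
    obtain ⟨F', hF', t, ht, rfl⟩ := hF
    obtain ⟨s, hs, hd, hv⟩ := ih _ F' hF'
    refine ⟨Fin.lastCases t s, Fin.lastCases (by simpa using ht) fun i => by simpa using hs i,
      fun b hb => Fin.lastCases (by simpa using hb.2) fun i => by simpa using hd b hb.1 i,
      fun b => ?_⟩
    change tmul (F'.vec b) (t.vec b) = _
    rw [hv]
    simp [tensorFamilyVec]

/-- The vector `⨂ᵢ sᵢ^kᵢ` in a fibre of `⨂ᵢ (q⁻¹ Lᵢ)^kᵢ`. -/
def tensorZpowVec {B' : SmoothSpace.{w}} {n : ℕ} (L : Fin n → HermitianLineBundle.{u} B)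
    (q : SmoothMap B' B) (k : Fin n → B' → ℤ) (hk : ∀ i, IsLocallyConstant (k i))
    (s : ∀ i b, (L i).fiber b) (b : B') :
    (tensorFamily fun i => ((L i).pullback q).zpow (k i) (hk i)).fiber b :=
  tensorFamilyVec _ b fun i => zpowVec (s i (q b)) (k i b)

/-- Each factor is a transition function of the bundle `(q⁻¹ Lᵢ)^kᵢ`, hence smooth; negative and
varying exponents have been dealt with in that bundle. The identification of the two needs unit
vectors, so it is made only on the common domain. -/
theorem smoothOn_prod_zpow {B' : SmoothSpace.{w}} {n : ℕ} (L : Fin n → HermitianLineBundle.{u} B)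
    (q : SmoothMap B' B) (k : Fin n → B' → ℤ) (hk : ∀ i, IsLocallyConstant (k i))
    (s t : ∀ i, UnitFrame (L i).fiber) (hs : ∀ i, s i ∈ (L i).frames)
    (ht : ∀ i, t i ∈ (L i).frames) :
    SmoothSpace.SmoothOn (fun b => ∏ i, ⟪(s i).vec (q b), (t i).vec (q b)⟫_ℂ ^ k i b)
      {b | ∀ i, q b ∈ (s i).domain ∧ q b ∈ (t i).domain} := by
  intro m p hp
  have : ∀ i, ContDiffOn ℝ ∞ (fun x => ⟪(s i).vec (q (p x)), (t i).vec (q (p x))⟫_ℂ ^ k i (p x))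
      (p ⁻¹' {b | ∀ i, q b ∈ (s i).domain ∧ q b ∈ (t i).domain}) := by
    intro i
    have h := (((L i).pullback q).zpow (k i) (hk i)).smooth_transition
      _ ⟨_, ⟨s i, hs i, rfl⟩, rfl⟩ _ ⟨_, ⟨t i, ht i, rfl⟩, rfl⟩
    have h' : SmoothSpace.SmoothOn (fun b => ⟪(s i).vec (q b), (t i).vec (q b)⟫_ℂ ^ k i b)
        {b | ∀ i, q b ∈ (s i).domain ∧ q b ∈ (t i).domain} :=
      (h.mono fun b (hb : ∀ i, q b ∈ (s i).domain ∧ q b ∈ (t i).domain) => hb i).congr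
          fun b hb =>
        (inner_zpowVec ((s i).norm_vec _ (hb i).1) ((t i).norm_vec _ (hb i).2) _).symm
    exact h' m p hp
  exact contDiffOn_prod fun i _ => this i

theorem inner_tensorZpowVec {B' : SmoothSpace.{w}} {n : ℕ}
    (L : Fin n → HermitianLineBundle.{u} B) (q : SmoothMap B' B) (k : Fin n → B' → ℤ)
    (hk : ∀ i, IsLocallyConstant (k i)) (s t : ∀ i b, (L i).fiber b) (b : B')
    (hs : ∀ i, ‖s i (q b)‖ = 1) (ht : ∀ i, ‖t i (q b)‖ = 1) :
    ⟪tensorZpowVec L q k hk s b, tensorZpowVec L q k hk t b⟫_ℂ =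
      ∏ i, ⟪s i (q b), t i (q b)⟫_ℂ ^ k i b := by
  refine (inner_tensorFamilyVec _ b _ _).trans (Finset.prod_congr rfl fun i _ => ?_)
  exact inner_zpowVec (hs i) (ht i) _

theorem norm_tensorZpowVec {B' : SmoothSpace.{w}} {n : ℕ}
    (L : Fin n → HermitianLineBundle.{u} B) (q : SmoothMap B' B) (k : Fin n → B' → ℤ)
    (hk : ∀ i, IsLocallyConstant (k i)) (s : ∀ i b, (L i).fiber b) (b : B')
    (hs : ∀ i, ‖s i (q b)‖ = 1) : ‖tensorZpowVec L q k hk s b‖ = 1 := by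
  refine norm_eq_one_of_inner_self ?_
  rw [inner_tensorZpowVec L q k hk s s b hs hs]
  exact Finset.prod_eq_one fun i _ => by rw [inner_self_eq_one (hs i), one_zpow]

theorem exists_of_mem_frames_tensorZpow {B' : SmoothSpace.{w}} {n : ℕ}
    (L : Fin n → HermitianLineBundle.{u} B) (q : SmoothMap B' B) (k : Fin n → B' → ℤ)
    (hk : ∀ i, IsLocallyConstant (k i))
    (F : UnitFrame (tensorFamily fun i => ((L i).pullback q).zpow (k i) (hk i)).fiber)
    (hF : F ∈ (tensorFamily fun i => ((L i).pullback q).zpow (k i) (hk i)).frames) :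
    ∃ s : ∀ i, UnitFrame (L i).fiber, (∀ i, s i ∈ (L i).frames) ∧
      (∀ b ∈ F.domain, ∀ i, q b ∈ (s i).domain) ∧
      ∀ b, F.vec b = tensorZpowVec L q k hk (fun i => (s i).vec) b := by
  obtain ⟨t, ht, hd, hv⟩ := exists_of_mem_frames_tensorFamily _ F hF
  -- Each `t i` is a power of a pulled back frame: `t' i` is the frame of the pullback, `s i` the
  -- frame of `L i` it comes from.
  choose t' ht' e' using ht
  choose s hs e using ht'
  refine ⟨s, hs, fun b hb i => ?_, fun b => (hv b).trans ?_⟩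
  · have := hd b hb i
    rw [← e' i, ← e i] at this
    exact this
  · refine congrArg (tensorFamilyVec _ b) (funext fun i => ?_)
    rw [← e' i, ← e i]
    rfl

end HermitianLineBundle

/-! ### Elementary tensors in finite reduced products of bundle gerbes -/

namespace BundleGerbe

open HermitianLineBundle

variable {X : SmoothSpace.{u}} {Y : SmoothSpace.{v}} {M : SmoothSpace.{w}}

/-- The elementary tensor `⨂ᵢ xᵢ` in a fibre of a reduced product. -/
def reducedProductFamilyVec {π : SmoothMap Y M} : {n : ℕ} → (P : Fin n → BundleGerbe.{l} π) →
    (p : pairs π) → (∀ i, (P i).bundle.fiber p) → (reducedProductFamily P).bundle.fiber p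
  | 0, _, _, _ => one
  | _ + 1, P, p, x =>
    tmul (reducedProductFamilyVec (fun i => P i.castSucc) p fun i => x i.castSucc) (x (Fin.last _))

/-- The multiplication of a reduced product acts factor by factor (`tensorMul_apply`), and the empty
product multiplies by `1 ⊗ 1 ↦ 1`. -/
theorem mulAt_reducedProductFamilyVec {π : SmoothMap Y M} {n : ℕ} (P : Fin n → BundleGerbe.{l} π)
    {y₁ y₂ y₃ : Y} (h₁₂ : π y₁ = π y₂) (h₂₃ : π y₂ = π y₃)
    (a : ∀ i, (P i).bundle.fiber ⟨(y₁, y₂), h₁₂⟩) (b : ∀ i, (P i).bundle.fiber ⟨(y₂, y₃), h₂₃⟩) :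
    mulAt (reducedProductFamily P).mul h₁₂ h₂₃
        (tmul (reducedProductFamilyVec P _ a) (reducedProductFamilyVec P _ b)) =
      reducedProductFamilyVec P _ fun i => mulAt (P i).mul h₁₂ h₂₃ (tmul (a i) (b i)) := by
  induction n with
  | zero => exact trivialMul_apply
  | succ n ih =>
    refine (tensorMul_apply (mulAt (reducedProductFamily fun i => P i.castSucc).mul h₁₂ h₂₃)
      (mulAt (P (Fin.last n)).mul h₁₂ h₂₃) _ _ _ _).trans ?_
    rw [ih]
    rfl

theorem inner_reducedProductFamilyVec {π : SmoothMap Y M} {n : ℕ} (P : Fin n → BundleGerbe.{l} π)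
    (p : pairs π) (x y : ∀ i, (P i).bundle.fiber p) :
    ⟪reducedProductFamilyVec P p x, reducedProductFamilyVec P p y⟫_ℂ = ∏ i, ⟪x i, y i⟫_ℂ := by
  induction n with
  | zero =>
    change ⟪(1 : ℂ), (1 : ℂ)⟫_ℂ = _
    simp
  | succ n ih =>
    rw [Fin.prod_univ_castSucc, ← ih]
    exact inner_tmul _ _ _ _

theorem exists_of_mem_frames_reducedProductFamily {π : SmoothMap Y M} {n : ℕ}
    (P : Fin n → BundleGerbe.{l} π) (F : UnitFrame (reducedProductFamily P).bundle.fiber)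
    (hF : F ∈ (reducedProductFamily P).bundle.frames) :
    ∃ s : ∀ i, UnitFrame (P i).bundle.fiber, (∀ i, s i ∈ (P i).bundle.frames) ∧
      (∀ p ∈ F.domain, ∀ i, p ∈ (s i).domain) ∧
      ∀ p, F.vec p = reducedProductFamilyVec P p fun i => (s i).vec p := by
  induction n with
  | zero =>
    refine ⟨fun i => i.elim0, fun i => i.elim0, fun _ _ i => i.elim0, fun b => ?_⟩
    cases hF
    rfl
  | succ n ih =>
    obtain ⟨F', hF', t, ht, rfl⟩ := hF
    obtain ⟨s, hs, hd, hv⟩ := ih _ F' hF'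
    refine ⟨Fin.lastCases t s, Fin.lastCases (by simpa using ht) fun i => by simpa using hs i,
      fun b hb => Fin.lastCases (by simpa using hb.2) fun i => by simpa using hd b hb.1 i,
      fun b => ?_⟩
    change tmul (F'.vec b) (t.vec b) = _
    rw [hv]
    simp [reducedProductFamilyVec]

/-! ### Vectors of a general cup product bundle gerbe given by unit sections -/

section GeneralCupProduct

variable {π : SmoothMap Y M} {n : ℕ} (L : Fin n → HermitianLineBundle.{l} M)
  (g : Fin n → pairs π → ℤ) (hg : ∀ i, IsLocallyConstant (g i)) (hδ : ∀ i, delta₂ π (g i) = 0)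

/-- The vector `⨂ᵢ sᵢ^gᵢ` in a fibre of a general cup product bundle gerbe. -/
def cupVec (s : ∀ i m, (L i).fiber m) (p : pairs π) :
    (generalCupProduct π L g hg hδ).bundle.fiber p :=
  reducedProductFamilyVec _ p fun i => zpowVec (s i (fiberProduct.proj π π p)) (g i p)

theorem inner_cupVec (s t : ∀ i m, (L i).fiber m) (p : pairs π)
    (hs : ∀ i, ‖s i (fiberProduct.proj π π p)‖ = 1)
    (ht : ∀ i, ‖t i (fiberProduct.proj π π p)‖ = 1) :
    ⟪cupVec L g hg hδ s p, cupVec L g hg hδ t p⟫_ℂ =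
      ∏ i, ⟪s i (fiberProduct.proj π π p), t i (fiberProduct.proj π π p)⟫_ℂ ^ g i p := by
  refine (inner_reducedProductFamilyVec _ p _ _).trans (Finset.prod_congr rfl fun i _ => ?_)
  exact inner_zpowVec (hs i) (ht i) _

theorem norm_cupVec (s : ∀ i m, (L i).fiber m) (p : pairs π)
    (hs : ∀ i, ‖s i (fiberProduct.proj π π p)‖ = 1) : ‖cupVec L g hg hδ s p‖ = 1 := by
  refine norm_eq_one_of_inner_self ?_
  rw [inner_cupVec L g hg hδ s s p hs hs]
  exact Finset.prod_eq_one fun i _ => by rw [inner_self_eq_one (hs i), one_zpow]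

theorem exists_of_mem_frames_generalCupProduct
    (F : UnitFrame (generalCupProduct π L g hg hδ).bundle.fiber)
    (hF : F ∈ (generalCupProduct π L g hg hδ).bundle.frames) :
    ∃ s : ∀ i, UnitFrame (L i).fiber, (∀ i, s i ∈ (L i).frames) ∧
      (∀ p ∈ F.domain, ∀ i, fiberProduct.proj π π p ∈ (s i).domain) ∧
      ∀ p, F.vec p = cupVec L g hg hδ (fun i => (s i).vec) p := by
  obtain ⟨t, ht, hd, hv⟩ := exists_of_mem_frames_reducedProductFamily _ F hF
  choose t' ht' e' using ht
  choose s hs e using ht'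
  refine ⟨s, hs, fun p hp i => ?_, fun p => (hv p).trans ?_⟩
  · have := hd p hp i
    rw [← e' i, ← e i] at this
    exact this
  · refine congrArg (reducedProductFamilyVec _ p) (funext fun i => ?_)
    rw [← e' i, ← e i]
    rfl

/-- In each factor `s^m ⊗ s^n ↦ s^(m + n)`, and `δ(g) = 0` makes the exponents add up correctly. -/
theorem mulAt_cupVec (s : ∀ i m, (L i).fiber m) {y₁ y₂ y₃ : Y} (h₁₂ : π y₁ = π y₂)
    (h₂₃ : π y₂ = π y₃) (hs : ∀ i, ‖s i (π y₁)‖ = 1) :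
    mulAt (generalCupProduct π L g hg hδ).mul h₁₂ h₂₃
        (tmul (cupVec L g hg hδ s ⟨(y₁, y₂), h₁₂⟩) (cupVec L g hg hδ s ⟨(y₂, y₃), h₂₃⟩)) =
      cupVec L g hg hδ s ⟨(y₁, y₃), h₁₂.trans h₂₃⟩ := by
  refine (mulAt_reducedProductFamilyVec _ h₁₂ h₂₃ _ _).trans ?_
  exact congrArg (reducedProductFamilyVec _ _) (funext fun i =>
    (L i).zpowMul_apply h₁₂ _ (s i) (hs i))

end GeneralCupProduct

/-! ### The isomorphism of `Q* ⊗ P` with the coboundary of `⨂ᵢ Lᵢ^hᵢ` -/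

section Trivialisation

variable (π' : SmoothMap X M) (π : SmoothMap Y M) {n : ℕ} (L : Fin n → HermitianLineBundle.{l} M)
  (f : Fin n → pairs π → ℤ) (hf : ∀ i, IsLocallyConstant (f i)) (hδf : ∀ i, delta₂ π (f i) = 0)
  (g : Fin n → pairs π' → ℤ) (hg : ∀ i, IsLocallyConstant (g i)) (hδg : ∀ i, delta₂ π' (g i) = 0)
  (h : Fin n → fiberProduct π' π → ℤ) (hh : ∀ i, IsLocallyConstant (h i))

/-- The bundle gerbe `Q* ⊗ P` for general cup product bundle gerbes `Q` and `P`. -/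
abbrev dualProduct : BundleGerbe.{l} (fiberProduct.proj π' π) :=
  (generalCupProduct π' L g hg hδg).dual.product (generalCupProduct π L f hf hδf)

/-- The line bundle `⨂ᵢ Lᵢ^hᵢ` over the fibre product. -/
abbrev trivialisingBundle : HermitianLineBundle.{l} (fiberProduct π' π) :=
  tensorFamily fun i => ((L i).pullback (fiberProduct.proj π' π)).zpow (h i) (hh i)

/-- The bundle `δ(R)` with fibre `R_{z₂} ⊗ R_{z₁}*`. -/
abbrev coboundary (R : HermitianLineBundle.{l} Y) : HermitianLineBundle.{l} (pairs π) :=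
  (R.pullback (pairs.face₁ π)).tensor (R.pullback (pairs.face₂ π)).dual

/-- The vector of `Q* ⊗ P` determined by unit sections of the `Lᵢ`. -/
def dualProductVec (s : ∀ i m, (L i).fiber m) (p : pairs (fiberProduct.proj π' π)) :
    (dualProduct π' π L f hf hδf g hg hδg).bundle.fiber p :=
  tmul (dualVec (cupVec L g hg hδg s (pairs.map (fiberProduct.fst π' π) (fun _ => rfl) p)))
    (cupVec L f hf hδf s
      (pairs.map (fiberProduct.snd π' π) (fun z => (Subtype.property z).symm) p))

/-- The vector of `δ(⨂ᵢ Lᵢ^hᵢ)` determined by unit sections of the `Lᵢ`. -/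
def coboundaryVec (s : ∀ i m, (L i).fiber m) (p : pairs (fiberProduct.proj π' π)) :
    (coboundary _ (trivialisingBundle π' π L h hh)).fiber p :=
  tmul (tensorZpowVec L (fiberProduct.proj π' π) h hh s (pairs.face₁ _ p))
    (dualVec (tensorZpowVec L (fiberProduct.proj π' π) h hh s (pairs.face₂ _ p)))

variable {π' π}

/-- The two routes from `X ×_M Y` to `M`, and the base points of `z₁` and `z₂`, agree only
propositionally, so unit length has to be transported between them. -/
theorem norm_of_eq {s : ∀ i m, (L i).fiber m} {m m' : M} (hs : ∀ i, ‖s i m‖ = 1) (e : m' = m) :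
    ∀ i, ‖s i m'‖ = 1 := e ▸ hs

theorem norm_dualProductVec (s : ∀ i m, (L i).fiber m) (p : pairs (fiberProduct.proj π' π))
    (hs : ∀ i, ‖s i (fiberProduct.proj _ _ p)‖ = 1) :
    ‖dualProductVec π' π L f hf hδf g hg hδg s p‖ = 1 :=
  norm_tmul_eq_one (norm_dualVec_eq_one (norm_cupVec L g hg hδg s _ hs))
    (norm_cupVec L f hf hδf s _ (norm_of_eq L hs (Subtype.property p.1.1).symm))

theorem norm_coboundaryVec (s : ∀ i m, (L i).fiber m) (p : pairs (fiberProduct.proj π' π))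
    (hs : ∀ i, ‖s i (fiberProduct.proj _ _ p)‖ = 1) : ‖coboundaryVec π' π L h hh s p‖ = 1 :=
  norm_tmul_eq_one
    (norm_tensorZpowVec L _ h hh s _ (norm_of_eq L hs (Subtype.property p).symm))
    (norm_dualVec_eq_one (norm_tensorZpowVec L _ h hh s _ hs))

theorem inner_dualProductVec (s t : ∀ i m, (L i).fiber m) (p : pairs (fiberProduct.proj π' π))
    (hs : ∀ i, ‖s i (fiberProduct.proj _ _ p)‖ = 1)
    (ht : ∀ i, ‖t i (fiberProduct.proj _ _ p)‖ = 1) :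
    ⟪dualProductVec π' π L f hf hδf g hg hδg s p, dualProductVec π' π L f hf hδf g hg hδg t p⟫_ℂ =
      ∏ i, ⟪s i (fiberProduct.proj _ _ p), t i (fiberProduct.proj _ _ p)⟫_ℂ ^
        (f i (pairs.map (fiberProduct.snd π' π) (fun z => (Subtype.property z).symm) p) -
          g i (pairs.map (fiberProduct.fst π' π) (fun _ => rfl) p)) := by
  have e := (Subtype.property p.1.1).symm
  have h₁ := (inner_dualVec _ _).trans (congrArg (starRingEnd ℂ) (inner_cupVec L g hg hδg s t
    (pairs.map (fiberProduct.fst π' π) (fun _ => rfl) p) hs ht))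
  have h₂ := inner_cupVec L f hf hδf s t
    (pairs.map (fiberProduct.snd π' π) (fun z => (Subtype.property z).symm) p)
    (norm_of_eq L hs e) (norm_of_eq L ht e)
  -- The base point is moved inside the scalar product formula, where no fibre type depends on it;
  -- the exponents stay at `p`.
  have h₃ := congrArg (fun m => ∏ i, ⟪s i m, t i m⟫_ℂ ^
    f i (pairs.map (fiberProduct.snd π' π) (fun z => (Subtype.property z).symm) p)) e
  exact (inner_tmul _ _ _ _).trans ((congrArg₂ (· * ·) h₁ (h₂.trans h₃)).trans
    (conj_prod_zpow_mul _ (fun i => norm_inner_eq_one (hs i) (ht i)) _ _))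

/-- The conjugated factor is the dual one, over `z₁`, so the exponents combine to `h(z₂) - h(z₁)`.
-/
theorem inner_coboundaryVec (s t : ∀ i m, (L i).fiber m) (p : pairs (fiberProduct.proj π' π))
    (hs : ∀ i, ‖s i (fiberProduct.proj _ _ p)‖ = 1)
    (ht : ∀ i, ‖t i (fiberProduct.proj _ _ p)‖ = 1) :
    ⟪coboundaryVec π' π L h hh s p, coboundaryVec π' π L h hh t p⟫_ℂ =
      ∏ i, ⟪s i (fiberProduct.proj _ _ p), t i (fiberProduct.proj _ _ p)⟫_ℂ ^
        delta₁ (fiberProduct.proj π' π) (h i) p := by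
  have e := (Subtype.property p).symm
  have h₁ := inner_tensorZpowVec L (fiberProduct.proj π' π) h hh s t (pairs.face₁ _ p)
    (norm_of_eq L hs e) (norm_of_eq L ht e)
  have h₂ := (inner_dualVec _ _).trans (congrArg (starRingEnd ℂ)
    (inner_tensorZpowVec L (fiberProduct.proj π' π) h hh s t (pairs.face₂ _ p) hs ht))
  have h₃ := congrArg (fun m => ∏ i, ⟪s i m, t i m⟫_ℂ ^ h i (pairs.face₁ _ p)) e
  exact (inner_tmul _ _ _ _).trans ((congrArg₂ (· * ·) (h₁.trans h₃) h₂).trans ((mul_comm _ _).trans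
    (conj_prod_zpow_mul _ (fun i => norm_inner_eq_one (hs i) (ht i)) _ _)))

/-- A family of (not necessarily continuous) unit sections. -/
def unitSection (i : Fin n) (m : M) : (L i).fiber m := ((L i).fiber m).exists_unit.choose

theorem norm_unitSection (i : Fin n) (m : M) : ‖unitSection L i m‖ = 1 :=
  ((L i).fiber m).exists_unit.choose_spec

/-- The fibrewise isomorphism `Q* ⊗ P ≃ δ(⨂ᵢ Lᵢ^hᵢ)`, which takes `dualProductVec` of unit sections
to their `coboundaryVec` (see `dualProductMap_apply`). -/
def dualProductMap (p : pairs (fiberProduct.proj π' π)) :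
    ((dualProduct π' π L f hf hδf g hg hδg).bundle.fiber p) ≃ₗᵢ[ℂ]
      ((coboundary _ (trivialisingBundle π' π L h hh)).fiber p) :=
  unitaryOfUnit
    (norm_dualProductVec L f hf hδf g hg hδg (unitSection L) p fun i => norm_unitSection L i _)
    (norm_coboundaryVec L h hh (unitSection L) p fun i => norm_unitSection L i _)

/-- Independence of the chosen unit section: passing from it to `s` changes the vectors in source
and target by the same phase. Only unit length of `s` at the base point of `p` is needed, so local
frames are allowed. -/
theorem dualProductMap_apply
    (hfg : ∀ i,
      f i ∘ pairs.map (fiberProduct.snd π' π) (fun z => (Subtype.property z).symm) -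
        g i ∘ pairs.map (fiberProduct.fst π' π) (fun _ => rfl) =
      delta₁ (fiberProduct.proj π' π) (h i))
    (s : ∀ i m, (L i).fiber m) (p : pairs (fiberProduct.proj π' π))
    (hs : ∀ i, ‖s i (fiberProduct.proj _ _ p)‖ = 1) :
    dualProductMap L f hf hδf g hg hδg h hh p (dualProductVec π' π L f hf hδf g hg hδg s p) =
      coboundaryVec π' π L h hh s p := by
  refine unitaryOfUnit_apply_of_inner_eq _ _ ?_
  refine (inner_dualProductVec L f hf hδf g hg hδg _ s p (fun i => norm_unitSection L i _) hs).trans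
    (Eq.trans ?_
      (inner_coboundaryVec L h hh _ s p (fun i => norm_unitSection L i _) hs).symm)
  -- The hypothesis `f - g = δ(h)` identifies the exponents.
  exact Finset.prod_congr rfl fun i _ => congrArg _ (congrFun (hfg i) p)

theorem mulAt_dualProductVec (s : ∀ i m, (L i).fiber m) {z₁ z₂ z₃ : fiberProduct π' π}
    (h₁₂ : fiberProduct.proj π' π z₁ = fiberProduct.proj π' π z₂)
    (h₂₃ : fiberProduct.proj π' π z₂ = fiberProduct.proj π' π z₃)
    (hs : ∀ i, ‖s i (fiberProduct.proj π' π z₁)‖ = 1) :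
    mulAt (dualProduct π' π L f hf hδf g hg hδg).mul h₁₂ h₂₃
      (tmul (dualProductVec π' π L f hf hδf g hg hδg s ⟨(z₁, z₂), h₁₂⟩)
        (dualProductVec π' π L f hf hδf g hg hδg s ⟨(z₂, z₃), h₂₃⟩)) =
      dualProductVec π' π L f hf hδf g hg hδg s ⟨(z₁, z₃), h₁₂.trans h₂₃⟩ := by
  -- The projection of `X ×_M Y` to `M` goes through `X`; the fibre product conditions turn `h₁₂`
  -- and `h₂₃` into equations for the `Y` coordinates.
  have e₁₂ := (Subtype.property z₁).symm.trans (h₁₂.trans (Subtype.property z₂))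
  have e₂₃ := (Subtype.property z₂).symm.trans (h₂₃.trans (Subtype.property z₃))
  have h₁ := (dualMul_apply _ _ _).trans (congrArg dualVec (mulAt_cupVec L g hg hδg s
    (y₁ := z₁.1.1) (y₂ := z₂.1.1) (y₃ := z₃.1.1) h₁₂ h₂₃ hs))
  have h₂ := mulAt_cupVec L f hf hδf s (y₁ := z₁.1.2) (y₂ := z₂.1.2) (y₃ := z₃.1.2) e₁₂ e₂₃
    (norm_of_eq L hs (Subtype.property z₁).symm)
  exact (tensorMul_apply _ _ _ _ _ _).trans (congrArg₂ tmul h₁ h₂)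

/-- The frames involved come from four families of frames of the `Lᵢ`: `sa` for `Q`, `sb` for `P`,
`sc` and `sd` for the two factors of the coboundary. Computing the map with `sd` as unit section
expresses its coefficient through transition functions of the `Lᵢ`. -/
theorem smoothOn_dualProductMap
    (hfg : ∀ i,
      f i ∘ pairs.map (fiberProduct.snd π' π) (fun z => (Subtype.property z).symm) -
        g i ∘ pairs.map (fiberProduct.fst π' π) (fun _ => rfl) =
      delta₁ (fiberProduct.proj π' π) (h i))
    (F : UnitFrame (dualProduct π' π L f hf hδf g hg hδg).bundle.fiber)
    (hF : F ∈ (dualProduct π' π L f hf hδf g hg hδg).bundle.frames)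
    (G : UnitFrame (coboundary _ (trivialisingBundle π' π L h hh)).fiber)
    (hG : G ∈ (coboundary _ (trivialisingBundle π' π L h hh)).frames) :
    SmoothSpace.SmoothOn
      (fun p => ⟪G.vec p, dualProductMap L f hf hδf g hg hδg h hh p (F.vec p)⟫_ℂ)
      (F.domain ∩ G.domain) := by
  obtain ⟨_, ⟨_, ⟨a, ha, rfl⟩, rfl⟩, _, ⟨b, hb, rfl⟩, rfl⟩ := hF
  obtain ⟨_, ⟨c, hc, rfl⟩, _, ⟨_, ⟨d, hd, rfl⟩, rfl⟩, rfl⟩ := hG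
  obtain ⟨sa, hsa, da, va⟩ := exists_of_mem_frames_generalCupProduct L g hg hδg a ha
  obtain ⟨sb, hsb, db, vb⟩ := exists_of_mem_frames_generalCupProduct L f hf hδf b hb
  obtain ⟨sc, hsc, dc, vc⟩ := exists_of_mem_frames_tensorZpow L (fiberProduct.proj π' π) h hh c hc
  obtain ⟨sd, hsd, dd, vd⟩ := exists_of_mem_frames_tensorZpow L (fiberProduct.proj π' π) h hh d hd
  -- The three factors of the coefficient: `sd` to `sa` with exponents `g`, conjugated for the dual;
  -- `sd` to `sb` with exponents `f`; and `sc` to `sd` with exponents `h(z₂)`.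
  have ma := ((smoothOn_prod_zpow L (fiberProduct.proj π' π') g hg sd sa hsd hsa).comp
    (pairs.map (π' := fiberProduct.proj π' π) (fiberProduct.fst π' π) (fun _ => rfl))).conj
  have mb := (smoothOn_prod_zpow L (fiberProduct.proj π π) f hf sd sb hsd hsb).comp
    (pairs.map (π' := fiberProduct.proj π' π) (fiberProduct.snd π' π)
      (fun z => (Subtype.property z).symm))
  have mc := (smoothOn_prod_zpow L (fiberProduct.proj π' π) h hh sc sd hsc hsd).comp
    (pairs.face₁ (fiberProduct.proj π' π))
  -- Membership in the domain of `sd` is known at the base point of `z₁` and is carried to the equal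
  -- points reached through `Y` and through `z₂`.
  have key : ∀ p : pairs (fiberProduct.proj π' π),
      (pairs.map (fiberProduct.fst π' π) (fun _ => rfl) p ∈ a.domain ∧
        pairs.map (fiberProduct.snd π' π) (fun z => (Subtype.property z).symm) p ∈ b.domain) ∧
      (pairs.face₁ _ p ∈ c.domain ∧ pairs.face₂ _ p ∈ d.domain) →
      (∀ i, π' p.1.1.1.1 ∈ (sd i).domain ∧ π' p.1.1.1.1 ∈ (sa i).domain) ∧
      (∀ i, π p.1.1.1.2 ∈ (sd i).domain ∧ π p.1.1.1.2 ∈ (sb i).domain) ∧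
      (∀ i, π' p.1.2.1.1 ∈ (sc i).domain ∧ π' p.1.2.1.1 ∈ (sd i).domain) := by
    rintro p ⟨⟨pa, pb⟩, pc, pd⟩
    have e₁ : π' p.1.1.1.1 = π p.1.1.1.2 := Subtype.property p.1.1
    have e₂ : π' p.1.1.1.1 = π' p.1.2.1.1 := Subtype.property p
    have pd' : ∀ i, π' p.1.1.1.1 ∈ (sd i).domain := dd _ pd
    exact ⟨fun i => ⟨pd' i, da _ pa i⟩, fun i => ⟨e₁ ▸ pd' i, db _ pb i⟩,
      fun i => ⟨dc _ pc i, e₂ ▸ pd' i⟩⟩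
  refine (((ma.mono fun p hp => (key p hp).1).mul (mb.mono fun p hp => (key p hp).2.1)).mul
    (mc.mono fun p hp => (key p hp).2.2)).congr fun p hp => ?_
  obtain ⟨ka, kb, kc⟩ := key p hp
  have nd : ∀ i, ‖(sd i).vec (fiberProduct.proj _ _ p)‖ = 1 := fun i =>
    (sd i).norm_vec _ (ka i).1
  -- The source frame is expanded along the unit vector built from `sd`, whose image is known.
  have eu := eq_smul (norm_dualProductVec L f hf hδf g hg hδg (fun i => (sd i).vec) p nd)
    (tmul (dualVec (a.vec (pairs.map (fiberProduct.fst π' π) (fun _ => rfl) p)))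
      (b.vec (pairs.map (fiberProduct.snd π' π) (fun z => (Subtype.property z).symm) p)))
  have em := (congrArg (dualProductMap L f hf hδf g hg hδg h hh p) eu).trans
    ((map_smul _ _ _).trans (congrArg (_ • ·)
      (dualProductMap_apply L f hf hδf g hg hδg h hh hfg _ p nd)))
  refine (congrArg (fun x => ⟪_, x⟫_ℂ) em).trans ((inner_smul_right _ _ _).trans
    (congrArg₂ (· * ·) ?_ ?_))
  · refine (inner_tmul _ _ _ _).trans (congrArg₂ (· * ·) ?_ ?_)
    · refine (inner_dualVec _ _).trans (congrArg (starRingEnd ℂ) ?_)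
      rw [va]
      exact inner_cupVec L g hg hδg _ _ _ (fun i => (sd i).norm_vec _ (ka i).1)
        (fun i => (sa i).norm_vec _ (ka i).2)
    · rw [vb]
      exact inner_cupVec L f hf hδf _ _ _ (fun i => (sd i).norm_vec _ (kb i).1)
        (fun i => (sb i).norm_vec _ (kb i).2)
  · refine (inner_tmul _ _ _ _).trans (Eq.trans (congrArg₂ (· * ·) ?_ ?_) (mul_one _))
    · rw [vc]
      exact inner_tensorZpowVec L _ h hh _ _ _ (fun i => (sc i).norm_vec _ (kc i).1)
        (fun i => (sd i).norm_vec _ (kc i).2)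
    -- The factor over `z₁` contributes `1`, because `d` is itself built from `sd`; this is why `sd`
    -- serves as the reference.
    · refine (congrArg (fun x => ⟪dualVec x, _⟫_ℂ) (vd (pairs.face₂ _ p))).trans ?_
      exact inner_self_eq_one (norm_dualVec_eq_one (norm_tensorZpowVec L _ h hh _ _ nd))

/-- The trivialisation of `Q* ⊗ P` with trivialising line bundle `⨂ᵢ Lᵢ^hᵢ`. -/
def dualProductTrivialisation
    (hfg : ∀ i,
      f i ∘ pairs.map (fiberProduct.snd π' π) (fun z => (Subtype.property z).symm) -
        g i ∘ pairs.map (fiberProduct.fst π' π) (fun _ => rfl) =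
      delta₁ (fiberProduct.proj π' π) (h i)) :
    Trivialisation (dualProduct π' π L f hf hδf g hg hδg)
    (trivialisingBundle π' π L h hh) where
  iso :=
    { map := dualProductMap L f hf hδf g hg hδg h hh
      smooth := smoothOn_dualProductMap L f hf hδf g hg hδg h hh hfg }
  map_mul := by
    intro z₁ z₂ z₃ h₁₂ h₂₃
    have hs : ∀ z : fiberProduct π' π, ∀ i, ‖unitSection L i (fiberProduct.proj π' π z)‖ = 1 :=
      fun z i => norm_unitSection L i _
    refine map_mul_of_unit (mulAt (dualProduct π' π L f hf hδf g hg hδg).mul h₁₂ h₂₃)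
      (dualProductMap L f hf hδf g hg hδg h hh ⟨(z₁, z₂), h₁₂⟩)
      (dualProductMap L f hf hδf g hg hδg h hh ⟨(z₂, z₃), h₂₃⟩)
      (dualProductMap L f hf hδf g hg hδg h hh ⟨(z₁, z₃), h₁₂.trans h₂₃⟩)
      (norm_dualProductVec L f hf hδf g hg hδg (unitSection L) ⟨(z₁, z₂), h₁₂⟩ (hs z₁))
      (norm_dualProductVec L f hf hδf g hg hδg (unitSection L) ⟨(z₂, z₃), h₂₃⟩ (hs z₂)) ?_
    have e₁₂ := dualProductMap_apply L f hf hδf g hg hδg h hh hfg _ ⟨(z₁, z₂), h₁₂⟩ (hs z₁)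
    have e₂₃ := dualProductMap_apply L f hf hδf g hg hδg h hh hfg _ ⟨(z₂, z₃), h₂₃⟩ (hs z₂)
    have e₁₃ := dualProductMap_apply L f hf hδf g hg hδg h hh hfg _
      ⟨(z₁, z₃), h₁₂.trans h₂₃⟩ (hs z₁)
    refine (congrArg _ (mulAt_dualProductVec L f hf hδf g hg hδg _ h₁₂ h₂₃ (hs z₁))).trans
      (e₁₃.trans (Eq.trans ?_ (congrArg₂ contract e₁₂ e₂₃).symm))
    -- The two coboundary vectors meet in `⨂ sᵢ^hᵢ(z₂)` and its dual vector.
    exact (contract_dualVec (norm_tensorZpowVec L _ h hh _ z₂ (hs z₂)) _ _).symm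

/-! ### Stable isomorphism by exchanging the two gerbes -/

/-- The exchange of the factors of a fibre product. -/
def fiberProductSwap (π : SmoothMap Y M) (π' : SmoothMap X M) :
    SmoothMap (fiberProduct π π') (fiberProduct π' π) :=
  ((fiberProduct.snd π π').prodMk (fiberProduct.fst π π')).codRestrict _
    fun z => (Subtype.property z).symm

theorem stablyIsomorphic_generalCupProduct (hh : ∀ i, IsLocallyConstant (h i))
    (hfg : ∀ i,
      f i ∘ pairs.map (fiberProduct.snd π' π) (fun z => (Subtype.property z).symm) -
        g i ∘ pairs.map (fiberProduct.fst π' π) (fun _ => rfl) =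
      delta₁ (fiberProduct.proj π' π) (h i)) :
    (generalCupProduct π L f hf hδf).StablyIsomorphic (generalCupProduct π' L g hg hδg) := by
  -- Exchanging `f` and `g` changes the sign of `f - g`, so `-h` composed with the swap is the
  -- required primitive on `Y ×_M X`.
  have hh' : ∀ i, IsLocallyConstant fun z => -h i (fiberProductSwap π π' z) := fun i =>
    ((hh i).comp_continuous (fiberProductSwap π π').continuous).neg
  refine ⟨_, ⟨dualProductTrivialisation L g hg hδg f hf hδf _ hh' fun i => funext fun p => ?_⟩⟩
  have e : ∀ z : fiberProduct π π', π' z.1.2 = π z.1.1 := fun z => (Subtype.property z).symm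
  have hp : π' p.1.1.1.2 = π' p.1.2.1.2 :=
    (e p.1.1).trans ((Subtype.property p).trans (e p.1.2).symm)
  -- The hypothesis is evaluated at the swapped pair; `hp` is needed because the projection to `M`
  -- now passes through `X` instead of `Y`.
  have := congrFun (hfg i) ⟨(fiberProductSwap π π' p.1.1, fiberProductSwap π π' p.1.2), hp⟩
  change f i (pairs.map (fiberProduct.fst π π') (fun _ => rfl) p) -
    g i (pairs.map (fiberProduct.snd π π') (fun z => (Subtype.property z).symm) p) =
    h i (fiberProductSwap π π' p.1.2) - h i (fiberProductSwap π π' p.1.1) at this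
  change g i (pairs.map (fiberProduct.snd π π') (fun z => (Subtype.property z).symm) p) -
    f i (pairs.map (fiberProduct.fst π π') (fun _ => rfl) p) =
    -h i (fiberProductSwap π π' p.1.2) - -h i (fiberProductSwap π π' p.1.1)
  omega

end Trivialisation

end BundleGerbe

end

/-! ### The result for surjective submersions of manifolds -/

theorem corollary3p5
    {EM HM EX HX EY HY : Type*}
    [NormedAddCommGroup EM] [NormedSpace ℝ EM] [FiniteDimensional ℝ EM] [TopologicalSpace HM]
    [NormedAddCommGroup EX] [NormedSpace ℝ EX] [FiniteDimensional ℝ EX] [TopologicalSpace HX]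
    [NormedAddCommGroup EY] [NormedSpace ℝ EY] [FiniteDimensional ℝ EY] [TopologicalSpace HY]
    (IM : ModelWithCorners ℝ EM HM) [IM.Boundaryless]
    (IX : ModelWithCorners ℝ EX HX) [IX.Boundaryless]
    (IY : ModelWithCorners ℝ EY HY) [IY.Boundaryless]
    (M : Type u) [TopologicalSpace M] [ChartedSpace HM M] [IsManifold IM ∞ M]
    (X : Type v) [TopologicalSpace X] [ChartedSpace HX X] [IsManifold IX ∞ X]
    (Y : Type w) [TopologicalSpace Y] [ChartedSpace HY Y] [IsManifold IY ∞ Y]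
    (πX : SurjectiveSubmersion IX X IM M) (πY : SurjectiveSubmersion IY Y IM M)
    {n : ℕ} (L : Fin n → HermitianLineBundle.{l} (SmoothSpace.ofManifold IM M))
    (f : Fin n → pairs πY.smoothMap → ℤ) (hf : ∀ i, IsLocallyConstant (f i))
    (hδf : ∀ i, delta₂ πY.smoothMap (f i) = 0)
    (g : Fin n → pairs πX.smoothMap → ℤ) (hg : ∀ i, IsLocallyConstant (g i))
    (hδg : ∀ i, delta₂ πX.smoothMap (g i) = 0)
    (h : Fin n → fiberProduct πX.smoothMap πY.smoothMap → ℤ) (hh : ∀ i, IsLocallyConstant (h i))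
    (hfg : ∀ i,
      -- the pullbacks of `f i` and `g i` along `(X ×_M Y)^[2] → Y^[2]` and `(X ×_M Y)^[2] → X^[2]`
      f i ∘ pairs.map (fiberProduct.snd πX.smoothMap πY.smoothMap)
          (fun z => (Subtype.property z).symm) -
        g i ∘ pairs.map (fiberProduct.fst πX.smoothMap πY.smoothMap) (fun _ => rfl) =
      delta₁ (fiberProduct.proj πX.smoothMap πY.smoothMap) (h i)) :
    (BundleGerbe.generalCupProduct πY.smoothMap L f hf hδf).StablyIsomorphic
        (BundleGerbe.generalCupProduct πX.smoothMap L g hg hδg) ∧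
      Nonempty (BundleGerbe.Trivialisation
        ((BundleGerbe.generalCupProduct πX.smoothMap L g hg hδg).dual.product
          (BundleGerbe.generalCupProduct πY.smoothMap L f hf hδf))
        (HermitianLineBundle.tensorFamily fun i =>
          ((L i).pullback (fiberProduct.proj πX.smoothMap πY.smoothMap)).zpow (h i) (hh i))) := by
  exact ⟨BundleGerbe.stablyIsomorphic_generalCupProduct L f hf hδf g hg hδg h hh hfg,
    ⟨BundleGerbe.dualProductTrivialisation L f hf hδf g hg hδg h hh hfg⟩⟩
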